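/- Let $M$ be a (connected) Riemann surface, let $e\in M$, and let $\Psi: M\setminus\{e\}\to\widehat{\mathbb C}$ be a meromorphic function with an essential singularity at $e$. Let $D(a,\rho)\subset\widehat{\mathbb C}$ denote the open disk of radius $\rho$ centred at $a$ in the spherical metric. For $a\in\widehat{\mathbb C}$ consider functions $U_a:\rho\mapsto U_a(\rho)$, $\rho>0$, such that $U_a(\rho)$ is a connected component of $\Psi^{-1}(D(a,\rho))\subset M\setminus\{e\}$ and $U_a(\rho_1)\subset U_a(\rho_2)$ whenever $\rho_1<\rho_2$. Such a $U_a$ is an *algebraic singularity* of $\Psi^{-1}$ if $\bigcap_{\rho>0}U_a(\rho)=\{z_0\}$, where $z_0$ is a critical point of $\Psi$ (a zero of $\Psi'$, or a multiple pole of $\Psi$). It is a *transcendental singularity* of $\Psi^{-1}$ if $\bigcap_{\rho>0}U_a(\rho)=\varnothing$; it is *at $e$* if moreover $e$ lies in the closure in $M$ of $U_a(\rho)$ for every $\rho>0$ (for compact $M$ this is automatic). The singularities of $\Psi^{-1}$ are the algebraic and the transcendental ones. A transcendental singularity $U_a$ is *logarithmic* if $\Psi:U_a(\rho)\to D(a,\rho)\setminus\{a\}$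 is a universal covering for some $\rho>0$. A singularity $U_a$ is *separate* if there is $\rho_1>0$ such that for every other singularity $U_b\neq U_a$ of $\Psi^{-1}$ (possibly with $b=a$) there is $\rho_2>0$ with $U_a(\rho_1)\cap U_b(\rho_2)=\varnothing$. Then a transcendental singularity $U_a$ of $\Psi^{-1}$ at $e$ is non-logarithmic if and only if it is non-separate. -/

import Mathlib

open scoped Manifold ContDiff Topology OnePoint

noncomputable section

namespace InverseSingularity

/-- The chordal distance on the Riemann sphere `ℂ ∪ {∞}` (embedded as the unit sphere of `ℝ³`). -/
def chordalDist : OnePoint ℂ → OnePoint ℂ → ℝ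
  | ∞, ∞ => 0
  | ∞, OnePoint.some w => 2 / √(1 + ‖w‖ ^ 2)
  | OnePoint.some z, ∞ => 2 / √(1 + ‖z‖ ^ 2)
  | OnePoint.some z, OnePoint.some w =>
      2 * ‖z - w‖ / (√(1 + ‖z‖ ^ 2) * √(1 + ‖w‖ ^ 2))

/-- The spherical (geodesic) distance on the Riemann sphere: a chord of length `c` subtends an
arc of length `2 arcsin (c / 2)`. -/
def sphericalDist (z w : OnePoint ℂ) : ℝ :=
  2 * Real.arcsin (chordalDist z w / 2)

/-- The open disk `D(a, ρ)` in the spherical metric. -/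
def sphericalDisk (a : OnePoint ℂ) (ρ : ℝ) : Set (OnePoint ℂ) :=
  {w | sphericalDist w a < ρ}

/-- The map `w ↦ 1 / w` from `ℂ` to the Riemann sphere, the coordinate at `∞`. -/
def recip (w : ℂ) : OnePoint ℂ :=
  open Classical in if w = 0 then ∞ else ((w⁻¹ : ℂ) : OnePoint ℂ)

section

variable {M : Type*} [TopologicalSpace M] [ChartedSpace ℂ M]

/-- `g` is a holomorphic local expression of `Ψ` at `p`, in the chart of `M` at `p` and one of
the two standard coordinates `t`, `1 / t` of the Riemann sphere. -/
def IsLocalExpr (Ψ : M → OnePoint ℂ) (p : M) (g : ℂ → ℂ) : Prop :=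
  AnalyticAt ℂ g (chartAt ℂ p p) ∧
    ((∀ᶠ q in 𝓝 p, Ψ q = (g (chartAt ℂ p q) : OnePoint ℂ)) ∨
      (∀ᶠ q in 𝓝 p, Ψ q = recip (g (chartAt ℂ p q))))

/-- `Ψ` is meromorphic at `p`, i.e. a holomorphic map to the Riemann sphere near `p`. -/
def IsMeromorphicAt (Ψ : M → OnePoint ℂ) (p : M) : Prop :=
  ∃ g : ℂ → ℂ, IsLocalExpr Ψ p g

/-- `p` is a critical point of `Ψ`: the derivative of `Ψ` vanishes at `p` when `Ψ p` is finite,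
and `p` is a multiple pole (a multiple zero of `1 / Ψ`) when `Ψ p = ∞`. -/
def IsCriticalPoint (Ψ : M → OnePoint ℂ) (p : M) : Prop :=
  ∃ g : ℂ → ℂ, IsLocalExpr Ψ p g ∧ deriv g (chartAt ℂ p p) = 0

/-- `Ψ` is meromorphic on `M ∖ {e}` and has an essential singularity at `e`: it has no limit in
the Riemann sphere at `e`. The value `Ψ e` plays no role. -/
def IsTranscendentalMeromorphic (Ψ : M → OnePoint ℂ) (e : M) : Prop :=
  (∀ p, p ≠ e → IsMeromorphicAt Ψ p) ∧
    ¬ ∃ c : OnePoint ℂ, Filter.Tendsto Ψ (𝓝[≠] e) (𝓝 c)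

end

section

variable {M : Type*} [TopologicalSpace M]

/-- The preimage of `D(a, ρ)` under `Ψ : M ∖ {e} → ℂ ∪ {∞}`. -/
def diskPreimage (Ψ : M → OnePoint ℂ) (e : M) (a : OnePoint ℂ) (ρ : ℝ) : Set M :=
  {z | z ≠ e ∧ Ψ z ∈ sphericalDisk a ρ}

/-- A function `ρ ↦ U_a(ρ)`, `ρ > 0`, that chooses in a monotone way a connected component of
`Ψ⁻¹(D(a, ρ))`. -/
@[ext]
structure Branch (Ψ : M → OnePoint ℂ) (e : M) where
  /-- The value over which the branch lies. -/
  value : OnePoint ℂ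
  /-- The neighbourhoods `U_a(ρ)`. -/
  nbhd : Set.Ioi (0 : ℝ) → Set M
  isComponent : ∀ ρ : Set.Ioi (0 : ℝ), ∃ z ∈ diskPreimage Ψ e value ρ,
    nbhd ρ = connectedComponentIn (diskPreimage Ψ e value ρ) z
  mono : Monotone nbhd

namespace Branch

variable {Ψ : M → OnePoint ℂ} {e : M}

/-- A transcendental singularity of `Ψ⁻¹`. -/
def IsTranscendental (U : Branch Ψ e) : Prop :=
  (⋂ ρ, U.nbhd ρ) = ∅

/-- An algebraic singularity of `Ψ⁻¹`. -/
def IsAlgebraic [ChartedSpace ℂ M] (U : Branch Ψ e) : Prop :=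
  ∃ z₀, (⋂ ρ, U.nbhd ρ) = {z₀} ∧ IsCriticalPoint Ψ z₀

/-- Singularities of `Ψ⁻¹`; the branches at ordinary points are not singularities. -/
def IsSingularity [ChartedSpace ℂ M] (U : Branch Ψ e) : Prop :=
  U.IsAlgebraic ∨ U.IsTranscendental

/-- The singularity `U` sits at the essential singularity `e`: all its neighbourhoods
accumulate at `e`. -/
def AccumulatesAtEssential (U : Branch Ψ e) : Prop :=
  ∀ ρ, e ∈ closure (U.nbhd ρ)

/-- A logarithmic singularity: `Ψ : U_a(ρ) → D(a, ρ) ∖ {a}` is a universal covering for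
some `ρ > 0`. -/
def IsLogarithmic (U : Branch Ψ e) : Prop :=
  U.IsTranscendental ∧
    ∃ ρ, ∃ h : Set.MapsTo Ψ (U.nbhd ρ) (sphericalDisk U.value ρ \ {U.value}),
      IsCoveringMap h.restrict ∧ SimplyConnectedSpace (U.nbhd ρ)

/-- `U` is separate: some neighbourhood `U_a(ρ₁)` is disjoint from a neighbourhood `U_b(ρ₂)` of
every other singularity `U_b`. The radius `ρ₁` does not depend on `U_b`. -/
def IsSeparate [ChartedSpace ℂ M] (U : Branch Ψ e) : Prop :=
  ∃ ρ₁, ∀ V : Branch Ψ e, V.IsSingularity → V ≠ U → ∃ ρ₂, Disjoint (U.nbhd ρ₁) (V.nbhd ρ₂)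

end Branch

end

end InverseSingularity

end

/-!
On the disk `D(a, ρ)`, `ρ ≤ π`, exponential polar coordinates around `a` are the universal covering
of the punctured disk by a half-plane. Near a separate transcendental singularity `U` there are no
critical points, and a lift of a path through `Ψ : U(ρ) → D(a, ρ)` cannot break off: it would
converge to another branch that meets all of `U(ρ)`, hence to one that is not a singularity, whose
centre is then the limit of the lift. So the polar coordinates lift to a map from the half-plane
onto `U(ρ)`. If the lift is injective, it is a homeomorphism and `U` is logarithmic. If it is not,
it is periodic, the circles `{d(Ψ, a) = r}` in `U(ρ)` are compact, and a punctured neighbourhood of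
`e` lies in `U(r)` for every `r`, so that `Ψ` tends to `a` at `e` against the hypothesis.

Conversely, let `Ψ` be a covering of the punctured disk by `U(ρ)`. A branch over a value `b ≠ a` of
the disk that always meets `U(ρ)` is the branch at an ordinary point, by a local section over `b`.
A branch over `a` that always meets `U(ρ)` is `U`, because the preimages of smaller disks in `U(ρ)`
are connected, being images of half-planes under a lift of the polar coordinates.
-/

noncomputable section

namespace InverseSingularity

open Filter Set Topology
open scoped MatrixGroups unitInterval

/-! ### The Riemann sphere -/

section Sphere

/-- The point `[u : v]` of the Riemann sphere in homogeneous coordinates; the junk value at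
`u = v = 0` is `∞`. -/
def ratio (u v : ℂ) : OnePoint ℂ :=
  if v = 0 then ∞ else ((u / v : ℂ) : OnePoint ℂ)

theorem ratio_one (z : ℂ) : ratio z 1 = z := by simp [ratio]

theorem ratio_zero (u : ℂ) : ratio u 0 = (∞ : OnePoint ℂ) := by simp [ratio]

theorem recip_eq_ratio (w : ℂ) : recip w = ratio 1 w := by simp [recip, ratio]

theorem exists_eq_ratio (x : OnePoint ℂ) : ∃ u v, ![u, v] ≠ 0 ∧ x = ratio u v := by
  induction x using OnePoint.rec with
  | infty => exact ⟨1, 0, by simp, (ratio_zero 1).symm⟩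
  | coe z => exact ⟨z, 1, by simp, (ratio_one z).symm⟩

theorem smul_ratio (g : GL (Fin 2) ℂ) {u v : ℂ} (h : ![u, v] ≠ 0) :
    g • ratio u v = ratio (g 0 0 * u + g 0 1 * v) (g 1 0 * u + g 1 1 * v) := by
  by_cases hv : v = 0
  · have hu : u ≠ 0 := by rintro rfl; simp [hv] at h
    rw [hv, ratio_zero, OnePoint.smul_infty_eq_ite]
    simp [ratio, hu, mul_div_mul_right]
  · have hsum : g 1 0 * u + g 1 1 * v = (g 1 0 * (u / v) + g 1 1) * v := by field_simp
    rw [ratio, if_neg hv, OnePoint.smul_some_eq_ite, ratio, hsum]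
    simp only [mul_eq_zero, hv, or_false]
    congr 2
    field_simp

theorem continuous_recip : Continuous recip := by
  have hinv {w : ℂ} (hw : w ≠ 0) : ((w⁻¹ : ℂ) : OnePoint ℂ) = recip w := by simp [recip, hw]
  refine continuous_iff_continuousAt.2 fun w => ?_
  rcases eq_or_ne w 0 with rfl | hw
  · rw [continuousAt_iff_punctured_nhds, show recip 0 = (∞ : OnePoint ℂ) by simp [recip]]
    have hlim : Tendsto (fun w : ℂ => ((w⁻¹ : ℂ) : OnePoint ℂ)) (𝓝[≠] 0) (𝓝 ∞) := by
      refine OnePoint.tendsto_coe_infty.comp ?_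
      rw [coclosedCompact_eq_cocompact, ← Metric.cobounded_eq_cocompact]
      exact tendsto_inv₀_nhdsNE_zero
    exact hlim.congr' (eventually_mem_nhdsWithin.mono fun w hw => hinv hw)
  · exact (OnePoint.continuous_coe.continuousAt.comp (continuousAt_inv₀ hw)).congr
      ((eventually_ne_nhds hw).mono fun v hv => hinv hv)

theorem continuousAt_ratio {u v : ℂ} (h : ![u, v] ≠ 0) :
    ContinuousAt (fun p : ℂ × ℂ => ratio p.1 p.2) (u, v) := by
  rcases eq_or_ne v 0 with rfl | hv
  · have hu : u ≠ 0 := by rintro rfl; simp at h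
    have hcont : ContinuousAt (fun p : ℂ × ℂ => recip (p.2 / p.1)) (u, 0) :=
      continuous_recip.continuousAt.comp (continuousAt_snd.div continuousAt_fst hu)
    refine hcont.congr ((continuousAt_fst.eventually_ne hu).mono fun p hp => ?_)
    simp [recip, ratio, hp]
  · refine (OnePoint.continuous_coe.continuousAt.comp
      (continuousAt_fst.div continuousAt_snd hv)).congr
      ((continuousAt_snd.eventually_ne hv).mono fun p hp => ?_)
    simp [ratio, hp]

theorem mul_add_mul_ne_zero (g : GL (Fin 2) ℂ) {u v : ℂ} (h : ![u, v] ≠ 0) :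
    ![g 0 0 * u + g 0 1 * v, g 1 0 * u + g 1 1 * v] ≠ 0 := by
  have hg : (g : Matrix (Fin 2) (Fin 2) ℂ).mulVec ![u, v] =
      ![g 0 0 * u + g 0 1 * v, g 1 0 * u + g 1 1 * v] := by
    simp
  rw [← hg]
  exact fun h0 => h (Matrix.eq_zero_of_mulVec_eq_zero g.det_ne_zero h0)

theorem smul_coe_eq_ratio (g : GL (Fin 2) ℂ) (z : ℂ) :
    g • (z : OnePoint ℂ) = ratio (g 0 0 * z + g 0 1) (g 1 0 * z + g 1 1) := by
  simpa [ratio_one] using smul_ratio g (u := z) (v := 1) (by simp)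

theorem continuous_smul_coe (g : GL (Fin 2) ℂ) :
    Continuous fun z : ℂ => g • (z : OnePoint ℂ) := by
  simp only [smul_coe_eq_ratio]
  refine continuous_iff_continuousAt.2 fun z => ?_
  have hz := mul_add_mul_ne_zero g (u := z) (v := 1) (by simp)
  simp only [mul_one] at hz
  exact (continuousAt_ratio hz).comp
    (f := fun z : ℂ => (g 0 0 * z + g 0 1, g 1 0 * z + g 1 1)) (by fun_prop)

/-- The inversion `z ↦ 1 / z`. -/
def inversion : GL (Fin 2) ℂ :=
  Matrix.GeneralLinearGroup.mkOfDetNeZero !![0, 1; 1, 0] (by simp)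

theorem inversion_smul_coe (w : ℂ) : inversion • (w : OnePoint ℂ) = recip w := by
  rw [smul_coe_eq_ratio, recip_eq_ratio]
  simp [inversion, Matrix.GeneralLinearGroup.mkOfDetNeZero]

theorem inversion_smul_infty : inversion • (∞ : OnePoint ℂ) = ((0 : ℂ) : OnePoint ℂ) := by
  simp [OnePoint.smul_infty_eq_ite, inversion, Matrix.GeneralLinearGroup.mkOfDetNeZero]

theorem continuous_inversion_smul : Continuous fun x : OnePoint ℂ => inversion • x := by
  refine (OnePoint.continuous_iff _).2 ⟨?_, continuous_smul_coe inversion⟩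
  simp only [inversion_smul_coe, inversion_smul_infty]
  rw [coclosedCompact_eq_cocompact, ← Metric.cobounded_eq_cocompact]
  refine (OnePoint.continuous_coe.continuousAt.tendsto.comp tendsto_inv₀_cobounded).congr' ?_
  filter_upwards [Bornology.eventually_ne_cobounded (0 : ℂ)] with w hw
  simp [recip, hw]

instance : ContinuousConstSMul (GL (Fin 2) ℂ) (OnePoint ℂ) where
  continuous_const_smul g := by
    refine continuous_iff_continuousAt.2 fun x => ?_
    induction x using OnePoint.rec with
    | coe z => exact OnePoint.continuousAt_coe.2 (continuous_smul_coe g).continuousAt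
    | infty =>
      have hg : (fun x : OnePoint ℂ => g • x) =
          (fun x => (g * inversion⁻¹) • x) ∘ fun x => inversion • x := by
        funext x; simp [mul_smul]
      rw [hg]
      refine ContinuousAt.comp ?_ continuous_inversion_smul.continuousAt
      rw [inversion_smul_infty]
      exact OnePoint.continuousAt_coe.2 (continuous_smul_coe _).continuousAt

theorem isOpenEmbedding_smul_coe (g : GL (Fin 2) ℂ) :
    IsOpenEmbedding fun z : ℂ => g • (z : OnePoint ℂ) :=
  (Homeomorph.smul g).isOpenEmbedding.comp OnePoint.isOpenEmbedding_coe

theorem isOpenEmbedding_recip : IsOpenEmbedding recip := by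
  simpa only [inversion_smul_coe] using isOpenEmbedding_smul_coe inversion

theorem chordalDist_ratio {u v s t : ℂ} (h : ![u, v] ≠ 0) (h' : ![s, t] ≠ 0) :
    chordalDist (ratio u v) (ratio s t) =
      2 * ‖u * t - s * v‖ / (√(‖u‖ ^ 2 + ‖v‖ ^ 2) * √(‖s‖ ^ 2 + ‖t‖ ^ 2)) := by
  have hsqrt (u : ℂ) {v : ℂ} (hv : v ≠ 0) :
      √(1 + ‖u / v‖ ^ 2) = √(‖u‖ ^ 2 + ‖v‖ ^ 2) / ‖v‖ := by
    have hv' : 0 < ‖v‖ := norm_pos_iff.2 hv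
    rw [← Real.sqrt_sq hv'.le, ← Real.sqrt_div (by positivity), Real.sqrt_sq hv'.le, norm_div]
    congr 1
    field_simp
    ring
  by_cases hv : v = 0 <;> by_cases ht : t = 0
  · simp [ratio, hv, ht, chordalDist]
  · have hu : 0 < ‖u‖ := norm_pos_iff.2 fun hu => by simp [hu, hv] at h
    have : 0 < ‖t‖ := norm_pos_iff.2 ht
    simp only [ratio, hv, ht, if_true, if_false, chordalDist, hsqrt s ht]
    simp only [norm_zero, zero_pow two_ne_zero, add_zero, mul_zero, sub_zero, norm_mul,
      Real.sqrt_sq hu.le]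
    field_simp
  · have hs : 0 < ‖s‖ := norm_pos_iff.2 fun hs => by simp [hs, ht] at h'
    have : 0 < ‖v‖ := norm_pos_iff.2 hv
    simp only [ratio, hv, ht, if_true, if_false, chordalDist, hsqrt u hv]
    simp only [norm_zero, zero_pow two_ne_zero, add_zero, mul_zero, zero_sub, norm_neg,
      norm_mul, Real.sqrt_sq hs.le]
    field_simp
  · have : 0 < ‖v‖ := norm_pos_iff.2 hv
    have : 0 < ‖t‖ := norm_pos_iff.2 ht
    have hsub : ‖u / v - s / t‖ = ‖u * t - s * v‖ / (‖v‖ * ‖t‖) := by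
      rw [div_sub_div _ _ hv ht, norm_div, norm_mul, mul_comm v s]
    simp only [ratio, hv, ht, if_false, chordalDist, hsqrt u hv, hsqrt s ht, hsub]
    field_simp

theorem norm_sq_add_norm_sq_pos {u v : ℂ} (h : ![u, v] ≠ 0) : 0 < ‖u‖ ^ 2 + ‖v‖ ^ 2 := by
  rcases eq_or_ne u 0 with rfl | hu
  · have hv : v ≠ 0 := by rintro rfl; simp at h
    positivity
  · positivity

open ComplexConjugate in
theorem exists_smul_zero_eq_and_chordalDist_smul (a : OnePoint ℂ) :
    ∃ g : GL (Fin 2) ℂ, g • ((0 : ℂ) : OnePoint ℂ) = a ∧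
      ∀ x, chordalDist (g • x) a = chordalDist x (0 : ℂ) := by
  obtain ⟨p, q, hpq, rfl⟩ := exists_eq_ratio a
  have hpos := norm_sq_add_norm_sq_pos hpq
  have hdet : conj q * q + p * conj p = ((‖p‖ ^ 2 + ‖q‖ ^ 2 : ℝ) : ℂ) := by
    rw [Complex.conj_mul', Complex.mul_conj']
    push_cast
    ring
  -- A positive multiple of the matrix in `SU(2)` that sends the line of `(0, 1)` to that of
  -- `(p, q)`.
  let g : GL (Fin 2) ℂ := Matrix.GeneralLinearGroup.mkOfDetNeZero !![conj q, p; -conj p, q] (by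
    rw [Matrix.det_fin_two_of, mul_neg, sub_neg_eq_add, hdet]
    exact_mod_cast hpos.ne')
  have hg (u v : ℂ) (h : ![u, v] ≠ 0) :
      g • ratio u v = ratio (conj q * u + p * v) (-conj p * u + q * v) := smul_ratio g h
  refine ⟨g, ?_, fun x => ?_⟩
  · rw [← ratio_one 0, hg 0 1 (by simp)]
    simp
  · obtain ⟨u, v, huv, rfl⟩ := exists_eq_ratio x
    have hnum : (conj q * u + p * v) * q - p * (-conj p * u + q * v) =
        ((‖p‖ ^ 2 + ‖q‖ ^ 2 : ℝ) : ℂ) * u := by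
      linear_combination u * hdet
    have hden : ‖conj q * u + p * v‖ ^ 2 + ‖-conj p * u + q * v‖ ^ 2 =
        (‖u‖ ^ 2 + ‖v‖ ^ 2) * (‖p‖ ^ 2 + ‖q‖ ^ 2) := by
      simp only [← Complex.normSq_eq_norm_sq, Complex.normSq_apply]
      simp
      ring
    have hguv : ![conj q * u + p * v, -conj p * u + q * v] ≠ 0 := mul_add_mul_ne_zero g huv
    rw [hg u v huv, chordalDist_ratio hguv hpq, ← ratio_one 0,
      chordalDist_ratio huv (by simp), hnum, norm_mul, Complex.norm_real,
      Real.norm_of_nonneg hpos.le, hden, Real.sqrt_mul (by positivity)]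
    have hsqrt : √(‖p‖ ^ 2 + ‖q‖ ^ 2) ^ 2 = ‖p‖ ^ 2 + ‖q‖ ^ 2 := Real.sq_sqrt hpos.le
    have huv' := (Real.sqrt_pos.2 (norm_sq_add_norm_sq_pos huv)).ne'
    have hpq' := (Real.sqrt_pos.2 hpos).ne'
    field_simp
    simp [hsqrt]

/-- A rotation of the sphere that moves `0` to `a`. -/
def rotation (a : OnePoint ℂ) : GL (Fin 2) ℂ :=
  (exists_smul_zero_eq_and_chordalDist_smul a).choose

theorem rotation_smul_zero (a : OnePoint ℂ) : rotation a • ((0 : ℂ) : OnePoint ℂ) = a :=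
  (exists_smul_zero_eq_and_chordalDist_smul a).choose_spec.1

theorem sphericalDist_rotation_smul (a x : OnePoint ℂ) :
    sphericalDist (rotation a • x) a = sphericalDist x (0 : ℂ) := by
  rw [sphericalDist, rotation, (exists_smul_zero_eq_and_chordalDist_smul a).choose_spec.2,
    sphericalDist]

theorem sphericalDist_coe_zero (z : ℂ) : sphericalDist z (0 : ℂ) = 2 * Real.arctan ‖z‖ := by
  simp only [sphericalDist, chordalDist, Real.arctan_eq_arcsin]
  congr 2
  simp
  ring

theorem sphericalDist_infty_zero : sphericalDist ∞ (0 : ℂ) = Real.pi := by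
  simp only [sphericalDist, chordalDist]
  norm_num
  ring

theorem sphericalDist_rotation_smul_coe (a : OnePoint ℂ) (z : ℂ) :
    sphericalDist (rotation a • (z : OnePoint ℂ)) a = 2 * Real.arctan ‖z‖ := by
  rw [sphericalDist_rotation_smul, sphericalDist_coe_zero]

theorem sphericalDist_self (a : OnePoint ℂ) : sphericalDist a a = 0 := by
  simpa [rotation_smul_zero] using sphericalDist_rotation_smul_coe a 0

/-- The point of the sphere opposite to `a`. -/
def antipode (a : OnePoint ℂ) : OnePoint ℂ := rotation a • (∞ : OnePoint ℂ)

theorem exists_eq_rotation_smul_coe {a x : OnePoint ℂ} (hx : x ≠ antipode a) :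
    ∃ z : ℂ, x = rotation a • (z : OnePoint ℂ) := by
  obtain ⟨z, hz⟩ := OnePoint.ne_infty_iff_exists.1
    (fun h => hx (by rw [antipode, ← h, smul_inv_smul]) : (rotation a)⁻¹ • x ≠ (∞ : OnePoint ℂ))
  exact ⟨z, by rw [hz, smul_inv_smul]⟩

theorem sphericalDist_antipode (a : OnePoint ℂ) : sphericalDist (antipode a) a = Real.pi := by
  rw [antipode, sphericalDist_rotation_smul, sphericalDist_infty_zero]

theorem sphericalDist_lt_pi {a x : OnePoint ℂ} :
    sphericalDist x a < Real.pi ↔ x ≠ antipode a := by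
  refine ⟨?_, fun hx => ?_⟩
  · rintro h rfl
    exact h.ne (sphericalDist_antipode a)
  · obtain ⟨z, rfl⟩ := exists_eq_rotation_smul_coe hx
    rw [sphericalDist_rotation_smul_coe]
    linarith [Real.arctan_lt_pi_div_two ‖z‖]

theorem eq_of_sphericalDist_le_zero {a x : OnePoint ℂ} (h : sphericalDist x a ≤ 0) : x = a := by
  obtain ⟨z, rfl⟩ := exists_eq_rotation_smul_coe (sphericalDist_lt_pi.1 (h.trans_lt Real.pi_pos))
  have hz : ‖z‖ ≤ 0 := not_lt.1 fun hz => by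
    linarith [sphericalDist_rotation_smul_coe a z, Real.arctan_pos.2 hz]
  rw [norm_le_zero_iff.1 hz, rotation_smul_zero]

theorem continuous_sphericalDist (a : OnePoint ℂ) : Continuous fun x => sphericalDist x a := by
  have hzero : Continuous fun x => sphericalDist x (0 : ℂ) := by
    refine (OnePoint.continuous_iff _).2 ⟨?_, ?_⟩
    · simp only [sphericalDist_coe_zero, sphericalDist_infty_zero, coclosedCompact_eq_cocompact]
      have harctan := Real.tendsto_arctan_atTop.mono_right (nhdsWithin_le_nhds (s := Iio _))
      simpa [mul_div_cancel₀] using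
        (harctan.comp (tendsto_norm_cocompact_atTop (E := ℂ))).const_mul 2
    · simp only [sphericalDist_coe_zero]
      fun_prop
  refine (hzero.comp (continuous_const_smul (rotation a)⁻¹)).congr fun x => ?_
  simp only [Function.comp, ← sphericalDist_rotation_smul a, smul_inv_smul]

theorem sphericalDisk_mono (a : OnePoint ℂ) : Monotone (sphericalDisk a) :=
  fun _ _ h _ hx => lt_of_lt_of_le hx h

theorem isOpen_sphericalDisk (a : OnePoint ℂ) (ρ : ℝ) : IsOpen (sphericalDisk a ρ) :=
  isOpen_Iio.preimage (continuous_sphericalDist a)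

theorem mem_sphericalDisk_self (a : OnePoint ℂ) {ρ : ℝ} (hρ : 0 < ρ) : a ∈ sphericalDisk a ρ :=
  (sphericalDist_self a).trans_lt hρ

theorem closure_sphericalDisk_subset (a : OnePoint ℂ) (ρ : ℝ) :
    closure (sphericalDisk a ρ) ⊆ {x | sphericalDist x a ≤ ρ} :=
  closure_lt_subset_le (continuous_sphericalDist a) continuous_const

theorem eq_of_forall_mem_sphericalDisk {a x : OnePoint ℂ}
    (h : ∀ ρ, 0 < ρ → x ∈ sphericalDisk a ρ) : x = a :=
  eq_of_sphericalDist_le_zero (le_of_forall_gt fun ρ hρ => h ρ hρ)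

theorem exists_sphericalDisk_subset {a : OnePoint ℂ} {N : Set (OnePoint ℂ)} (hN : N ∈ 𝓝 a) :
    ∃ ρ, 0 < ρ ∧ sphericalDisk a ρ ⊆ N := by
  let V (ρ : Ioi (0 : ℝ)) : Set (OnePoint ℂ) := {x | sphericalDist x a ≤ ρ}
  have hV_anti : Directed (· ⊇ ·) V :=
    Monotone.directed_ge fun _ _ h x (hx : sphericalDist x a ≤ _) => hx.trans h
  have hV_closed (ρ) : IsClosed (V ρ) :=
    isClosed_le (continuous_sphericalDist a) continuous_const
  have hV_nhds : ∀ x ∈ ⋂ ρ, V ρ, N ∈ 𝓝 x := fun x hx => by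
    rwa [eq_of_sphericalDist_le_zero
      (le_of_forall_gt_imp_ge_of_dense fun ρ hρ => mem_iInter.1 hx ⟨ρ, hρ⟩)]
  obtain ⟨⟨ρ, hρ⟩, hsub⟩ := exists_subset_nhds_of_compactSpace hV_anti hV_closed hV_nhds
  exact ⟨ρ, hρ, fun x hx => hsub (le_of_lt (show sphericalDist x a < ρ from hx))⟩

end Sphere

/-! ### Exponential polar coordinates -/

section Polar

open Complex in
/-- Exponential polar coordinates around `a`: the universal covering of the sphere without `a`
and its antipode. It maps left half-planes onto the punctured spherical disks around `a`. -/
def polar (a : OnePoint ℂ) (z : ℂ) : OnePoint ℂ :=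
  rotation a • (exp z : OnePoint ℂ)

/-- The set of `z` with `polar a z ∈ D(a, ρ)`, a left half-plane for `0 < ρ < π` and the whole
plane for `π ≤ ρ`. -/
def polarDisk (ρ : ℝ) : Set ℂ := {z | 2 * Real.arctan (Real.exp z.re) < ρ}

variable {a x : OnePoint ℂ} {z w : ℂ} {ρ : ℝ}

theorem sphericalDist_polar (a : OnePoint ℂ) (z : ℂ) :
    sphericalDist (polar a z) a = 2 * Real.arctan (Real.exp z.re) := by
  rw [polar, sphericalDist_rotation_smul_coe, Complex.norm_exp]

theorem polar_mem_sphericalDisk : polar a z ∈ sphericalDisk a ρ ↔ z ∈ polarDisk ρ := by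
  rw [sphericalDisk, mem_ofPred_eq, sphericalDist_polar]
  rfl

theorem polar_ne (a : OnePoint ℂ) (z : ℂ) : polar a z ≠ a := fun h => by
  have hpos : 0 < 2 * Real.arctan (Real.exp z.re) := by positivity
  rw [← sphericalDist_polar a z, h, sphericalDist_self] at hpos
  exact hpos.false

theorem polar_eq_polar_iff :
    polar a z = polar a w ↔ ∃ n : ℤ, z = w + n * (2 * Real.pi * Complex.I) := by
  rw [polar, polar, smul_left_cancel_iff, OnePoint.coe_eq_coe, Complex.exp_eq_exp_iff_exists_int]

theorem polar_add_int_mul (a : OnePoint ℂ) (z : ℂ) (n : ℤ) :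
    polar a (z + n * (2 * Real.pi * Complex.I)) = polar a z :=
  polar_eq_polar_iff.2 ⟨n, rfl⟩

theorem exists_polar_eq (hxa : x ≠ a) (hx : x ≠ antipode a) : ∃ z, polar a z = x := by
  obtain ⟨y, rfl⟩ := exists_eq_rotation_smul_coe hx
  have hy : y ≠ 0 := by
    rintro rfl
    exact hxa (rotation_smul_zero a)
  exact ⟨Complex.log y, by rw [polar, Complex.exp_log hy]⟩

theorem range_polar (a : OnePoint ℂ) : range (polar a) = {a, antipode a}ᶜ := by
  ext x
  simp only [mem_range, mem_compl_iff, mem_insert_iff, mem_singleton_iff, not_or]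
  refine ⟨?_, fun h => exists_polar_eq h.1 h.2⟩
  rintro ⟨z, rfl⟩
  refine ⟨polar_ne a z, sphericalDist_lt_pi.1 ?_⟩
  linarith [sphericalDist_polar a z, Real.arctan_lt_pi_div_two (Real.exp z.re)]

theorem sphericalDisk_sdiff_center_subset_range_polar (hρ : ρ ≤ Real.pi) :
    sphericalDisk a ρ \ {a} ⊆ range (polar a) := fun _ hx =>
  exists_polar_eq hx.2 (sphericalDist_lt_pi.1 (hx.1.trans_le hρ))

theorem dense_range_polar (a : OnePoint ℂ) : Dense (range (polar a)) := by
  rw [range_polar, compl_eq_univ_sdiff]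
  exact dense_univ.sdiff_finite (toFinite _)

theorem isCoveringMapOn_polar (a : OnePoint ℂ) : IsCoveringMapOn (polar a) (range (polar a)) := by
  have hemb := isOpenEmbedding_smul_coe (rotation a)
  have himg : (fun z : ℂ => rotation a • (z : OnePoint ℂ)) '' {z | z ≠ 0} = range (polar a) := by
    have hexp : {z : ℂ | z ≠ 0} = range Complex.exp := Complex.range_exp.symm
    rw [hexp, ← range_comp]
    rfl
  have hopen : IsOpen (range (polar a)) := himg ▸ hemb.isOpenMap _ isOpen_ne
  let τ := (hemb.isEmbedding.homeomorphImage {z | z ≠ 0}).trans (Homeomorph.setCongr himg)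
  exact .of_isCoveringMap_subtype (f := polar a) hopen mem_range_self
    (Complex.isCoveringMap_exp.homeomorph_comp τ)

theorem isLocalHomeomorph_polar (a : OnePoint ℂ) : IsLocalHomeomorph (polar a) :=
  isLocalHomeomorph_iff_isLocalHomeomorphOn_univ.2 <| by
    simpa using (isCoveringMapOn_polar a).isLocalHomeomorphOn

theorem continuous_polar (a : OnePoint ℂ) : Continuous (polar a) :=
  (isLocalHomeomorph_polar a).continuous

theorem isOpen_polarDisk (ρ : ℝ) : IsOpen (polarDisk ρ) :=
  isOpen_lt (by fun_prop) continuous_const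

theorem convex_polarDisk (ρ : ℝ) : Convex ℝ (polarDisk ρ) := by
  have hmono : StrictMono fun t => 2 * Real.arctan (Real.exp t) := fun s t h => by
    simpa using Real.arctan_strictMono (Real.exp_strictMono h)
  exact (ordConnected_Iio.preimage_mono hmono.monotone).convex.is_linear_preimage
    Complex.reLm.isLinear

theorem nonempty_polarDisk (hρ : 0 < ρ) : (polarDisk ρ).Nonempty := by
  have hlim : Tendsto (fun t => 2 * Real.arctan (Real.exp t)) atBot (𝓝 0) := by
    simpa using ((Real.continuous_arctan.tendsto 0).comp Real.tendsto_exp_atBot).const_mul 2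
  obtain ⟨t, ht⟩ := (hlim.eventually_lt_const hρ).exists
  exact ⟨t, by simpa [polarDisk] using ht⟩

theorem isPreconnected_sphericalDisk (a : OnePoint ℂ) (ρ : ℝ) :
    IsPreconnected (sphericalDisk a ρ) := by
  have himage : polar a '' polarDisk ρ = sphericalDisk a ρ ∩ range (polar a) := by
    rw [← image_univ, ← image_preimage_inter, inter_univ]
    exact congrArg _ (ext fun z => polar_mem_sphericalDisk.symm)
  have hconn : IsPreconnected (sphericalDisk a ρ ∩ range (polar a)) := himage ▸
    (convex_polarDisk ρ).isPreconnected.image _ (continuous_polar a).continuousOn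
  exact hconn.subset_closure inter_subset_left
    ((dense_range_polar a).open_subset_closure_inter (isOpen_sphericalDisk a ρ))

end Polar

/-! ### Lifting through local homeomorphisms -/

section Lifting

theorem isPreconnected_preimage_subtypeVal {X : Type*} [TopologicalSpace X] {s t : Set X}
    (hs : IsPreconnected s) (hst : s ⊆ t) : IsPreconnected (Subtype.val ⁻¹' s : Set t) := by
  rwa [← IsInducing.subtypeVal.isPreconnected_image, Subtype.image_preimage_coe,
    inter_eq_right.2 hst]

variable {X Y : Type*} [TopologicalSpace X] {q : X → Y}

/-- `c` is a lift of the curve `γ` through `q`, over the set `s` of times and starting at `x₀`. -/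
structure IsCurveLift (q : X → Y) (γ : ℝ → Y) (x₀ : X) (s : Set ℝ) (c : ℝ → X) : Prop where
  continuousOn : ContinuousOn c s
  apply_zero : c 0 = x₀
  map_apply : ∀ u ∈ s, q (c u) = γ u

namespace IsCurveLift

variable {γ : ℝ → Y} {x₀ x : X} {s s' : Set ℝ} {c c' : ℝ → X} {t : ℝ}

theorem mono (h : IsCurveLift q γ x₀ s c) (hs : s' ⊆ s) : IsCurveLift q γ x₀ s' c :=
  ⟨h.continuousOn.mono hs, h.apply_zero, fun u hu => h.map_apply u (hs hu)⟩

variable [TopologicalSpace Y]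

theorem eqOn [T2Space X] (hq : IsLocalHomeomorph q) (h : IsCurveLift q γ x₀ s c)
    (h' : IsCurveLift q γ x₀ s c') (hs : IsPreconnected s) (h0 : 0 ∈ s) : EqOn c c' s :=
  (T2Space.isSeparatedMap q).eqOn_of_comp_eqOn hq.isLocallyInjective hs h.continuousOn
    h'.continuousOn (fun u hu => (h.map_apply u hu).trans (h'.map_apply u hu).symm) h0
    (h.apply_zero.trans h'.apply_zero.symm)

theorem exists_Ico [T2Space X] (hq : IsLocalHomeomorph q) (ht : 0 < t)
    (h : ∀ s ∈ Ico 0 t, ∃ s' > s, ∃ c, IsCurveLift q γ x₀ (Icc 0 s') c) :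
    ∃ c, IsCurveLift q γ x₀ (Ico 0 t) c := by
  have : Nonempty X := ⟨x₀⟩
  choose! T hT C hC using h
  have agree : ∀ s ∈ Ico 0 t, ∀ u ∈ Ico 0 t, u ≤ T s → C u u = C s u := fun s hs u hu hus =>
    ((hC u hu).mono (Icc_subset_Icc_right (hT u hu).le)).eqOn hq
      ((hC s hs).mono (Icc_subset_Icc_right hus)) isPreconnected_Icc (left_mem_Icc.2 hu.1)
      (right_mem_Icc.2 hu.1)
  refine ⟨fun s => C s s, fun s hs => ?_, (hC 0 ⟨le_rfl, ht⟩).apply_zero,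
    fun s hs => (hC s hs).map_apply s ⟨hs.1, (hT s hs).le⟩⟩
  have hCs : ContinuousWithinAt (C s) (Ico 0 t ∩ Iic (T s)) s :=
    ((hC s hs).continuousOn s ⟨hs.1, (hT s hs).le⟩).mono fun u hu => ⟨hu.1.1, hu.2⟩
  exact (continuousWithinAt_inter (Iic_mem_nhds (hT s hs))).1
    (hCs.congr (fun u hu => agree s hs u hu.1 hu.2) rfl)

theorem update [T2Space Y] (hq : Continuous q) (hγ : Continuous γ) (ht : 0 < t)
    (h : IsCurveLift q γ x₀ (Ico 0 t) c) (hx : Tendsto c (𝓝[<] t) (𝓝 x)) :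
    IsCurveLift q γ x₀ (Icc 0 t) (Function.update c t x) where
  continuousOn := by
    rw [continuousOn_update_iff, Icc_sdiff_right, nhdsWithin_Ico_eq_nhdsLT ht]
    exact ⟨h.continuousOn, fun _ => hx⟩
  apply_zero := by rw [Function.update_of_ne ht.ne, h.apply_zero]
  map_apply u hu := by
    rcases hu.2.eq_or_lt with rfl | hut
    · have hlim : Tendsto γ (𝓝[<] u) (𝓝 (q x)) := ((hq.tendsto x).comp hx).congr' <| by
        filter_upwards [Ico_mem_nhdsLT ht] with s hs using h.map_apply s hs
      rw [Function.update_self]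
      exact tendsto_nhds_unique hlim (hγ.continuousAt.tendsto.mono_left nhdsWithin_le_nhds)
    · rw [Function.update_of_ne hut.ne]
      exact h.map_apply u ⟨hu.1, hut⟩

theorem eventually_exists (hq : IsLocalHomeomorph q) (hγ : Continuous γ) (ht : 0 ≤ t)
    (h : IsCurveLift q γ x₀ (Icc 0 t) c) :
    ∀ᶠ s in 𝓝[>] t, ∃ c, IsCurveLift q γ x₀ (Icc 0 s) c := by
  obtain ⟨φ, hφ, rfl⟩ := hq (c t)
  have hct : φ (c t) = γ t := h.map_apply t ⟨ht, le_rfl⟩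
  have hnear : ∀ᶠ s in 𝓝[≥] t, γ s ∈ φ.target := nhdsWithin_le_nhds <|
    hγ.continuousAt (φ.open_target.mem_nhds (hct ▸ φ.map_source hφ))
  obtain ⟨s₀, hs₀, hsub⟩ := mem_nhdsGE_iff_exists_Ico_subset.1 hnear
  filter_upwards [Ioo_mem_nhdsGT hs₀] with s hs
  have hsub : MapsTo γ (Icc t s) φ.target := fun u hu => hsub ⟨hu.1, hu.2.trans_lt hs.2⟩
  have hagree : ∀ u ∈ Icc 0 s ∩ frontier {u | u ≤ t}, c u = φ.symm (γ u) := by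
    rintro u ⟨-, hu⟩
    obtain rfl : u = t := frontier_Iic.subset hu
    rw [← hct, φ.left_inv hφ]
  refine ⟨fun u => if u ≤ t then c u else φ.symm (γ u), ?_, ?_, fun u hu => ?_⟩
  · refine ContinuousOn.if hagree ?_ ?_
    · exact h.continuousOn.mono fun u hu => ⟨hu.1.1, closure_Iic t |>.subset hu.2⟩
    · refine φ.continuousOn_symm.comp hγ.continuousOn fun u hu => hsub ⟨?_, hu.1.2⟩
      exact closure_minimal (fun v hv => (not_le.1 hv).le) isClosed_Ici hu.2
  · rw [if_pos ht, h.apply_zero]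
  · split_ifs with hut
    · exact h.map_apply u ⟨hu.1, hut⟩
    · exact φ.right_inv (hsub ⟨(not_le.1 hut).le, hu.2⟩)

end IsCurveLift

variable [TopologicalSpace Y]

theorem exists_path_lift_of_forall_tendsto [T2Space X] [T2Space Y] (hq : IsLocalHomeomorph q)
    (γ : C(I, Y)) {x₀ : X} (h0 : q x₀ = γ 0)
    (hlim : ∀ t ∈ Ioc (0 : ℝ) 1, ∀ c, IsCurveLift q (IccExtend zero_le_one γ) x₀ (Ico 0 t) c →
      ∃ x, Tendsto c (𝓝[<] t) (𝓝 x)) :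
    ∃ Γ : C(I, X), Γ 0 = x₀ ∧ ∀ t, q (Γ t) = γ t := by
  have hγ : Continuous (IccExtend zero_le_one γ) := γ.continuous.Icc_extend'
  let A : Set ℝ := {t | ∃ c, IsCurveLift q (IccExtend zero_le_one γ) x₀ (Icc 0 t) c}
  have h0A : 0 ∈ A := ⟨fun _ => x₀, continuousOn_const, rfl, fun u hu => by
    rw [Icc_self, mem_singleton_iff] at hu
    simpa [hu] using h0⟩
  have hclosed : IsClosed (A ∩ Icc 0 1) := isClosed_of_closure_subset fun t ht => by
    have htI : t ∈ Icc (0 : ℝ) 1 := closure_minimal inter_subset_right isClosed_Icc ht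
    refine ⟨?_, htI⟩
    rcases htI.1.eq_or_lt with rfl | htpos
    · exact h0A
    by_contra htA
    obtain ⟨c, hc⟩ := IsCurveLift.exists_Ico (γ := IccExtend zero_le_one γ) (x₀ := x₀) hq htpos
      fun s hs => by
        obtain ⟨s', hs', hs'A, -⟩ := mem_closure_iff.1 ht (Ioi s) isOpen_Ioi hs.2
        exact ⟨s', hs', hs'A⟩
    obtain ⟨x, hx⟩ := hlim t ⟨htpos, htI.2⟩ c hc
    exact htA ⟨_, hc.update hq.continuous hγ htpos hx⟩
  have hsub : Icc 0 1 ⊆ A := hclosed.Icc_subset_of_forall_mem_nhdsWithin h0A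
    fun t ⟨⟨c, hc⟩, ht⟩ => hc.eventually_exists hq hγ ht.1
  obtain ⟨c, hc⟩ := hsub (right_mem_Icc.2 zero_le_one)
  refine ⟨⟨fun t => c t, hc.continuousOn.comp_continuous continuous_subtype_val fun t => t.2⟩,
    hc.apply_zero, fun t => ?_⟩
  simpa using hc.map_apply t t.2

theorem exists_lift_of_convex {E : Type*} [AddCommGroup E] [Module ℝ E] [TopologicalSpace E]
    [IsTopologicalAddGroup E] [ContinuousSMul ℝ E] {P : Set E} (hP : Convex ℝ P) [T2Space X]
    (hq : IsLocalHomeomorph q) (f : C(P, Y)) {z₀ : P} {x₀ : X} (hx₀ : q x₀ = f z₀)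
    (hlift : ∀ γ : C(I, Y), (∀ t, γ t ∈ range f) → q x₀ = γ 0 →
      ∃ Γ : C(I, X), Γ 0 = x₀ ∧ ∀ t, q (Γ t) = γ t) :
    ∃ F : C(P, X), F z₀ = x₀ ∧ ∀ z, q (F z) = f z := by
  let seg : C(I × P, P) := ⟨fun p => ⟨(1 - (p.1 : ℝ)) • (z₀ : E) + (p.1 : ℝ) • (p.2 : E),
    hP z₀.2 p.2.2 (sub_nonneg.2 p.1.2.2) p.1.2.1 (sub_add_cancel _ _)⟩, by fun_prop⟩
  have hseg0 : ∀ z, seg (0, z) = z₀ := fun z => Subtype.ext (by simp [seg])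
  have hseg1 : ∀ z, seg (1, z) = z := fun z => Subtype.ext (by simp [seg])
  have hsegz₀ : ∀ t, seg (t, z₀) = z₀ := fun t =>
    Subtype.ext ((add_smul _ _ _).symm.trans (by simp))
  have hex : ∀ z, ∃ Γ : C(I, X), Γ 0 = x₀ ∧ ∀ t, q (Γ t) = f (seg (t, z)) := fun z =>
    hlift ((f.comp seg).comp ⟨fun t => (t, z), by fun_prop⟩) (fun t => mem_range_self _)
      (by simpa [hseg0] using hx₀)
  choose Γ hΓ0 hΓq using hex
  have hcont : Continuous fun p : I × P => Γ p.2 p.1 :=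
    hq.continuous_lift (T2Space.isSeparatedMap q) (f.comp seg) (funext fun p => hΓq p.2 p.1)
      (by simpa only [hΓ0] using continuous_const) fun z => (Γ z).continuous
  have hΓz₀ : ⇑(Γ z₀) = fun _ => x₀ :=
    (T2Space.isSeparatedMap q).eq_of_comp_eq hq.isLocallyInjective (Γ z₀).continuous
      continuous_const (funext fun t => by simp [hΓq, hsegz₀, hx₀]) 0 (hΓ0 z₀)
  exact ⟨⟨fun z => Γ z 1, hcont.comp (Continuous.prodMk_right (1 : I))⟩, congrFun hΓz₀ 1,
    fun z => (hΓq z 1).trans (by rw [hseg1])⟩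

theorem exists_section_of_isEvenlyCovered {F : Type*} [TopologicalSpace F] {b : Y}
    (h : IsEvenlyCovered q b F) : ∃ N ∈ 𝓝 b, ∀ A : Set X, IsPreconnected A → A.Nonempty →
      ∀ hAN : MapsTo q A N, ∃ s : C(N, X), (∀ y, q (s y) = y) ∧
        ∀ x (hx : x ∈ A), s ⟨q x, hAN hx⟩ = x := by
  have : DiscreteTopology F := h.1
  obtain ⟨-, N, hbN, hNo, -, H, hH⟩ := h
  refine ⟨N, hNo.mem_nhds hbN, fun A hA ⟨x₀, hx₀⟩ hAN => ?_⟩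
  let sheet (x : A) : F := (H ⟨x, hAN x.2⟩).2
  have hsheet : ∀ x, sheet x = sheet ⟨x₀, hx₀⟩ := fun x =>
    have := isPreconnected_iff_preconnectedSpace.1 hA
    PreconnectedSpace.constant this (f := sheet) (by fun_prop)
  refine ⟨⟨fun y => H.symm (y, sheet ⟨x₀, hx₀⟩), by fun_prop⟩, fun y => ?_, fun x hx => ?_⟩
  · rw [ContinuousMap.coe_mk, ← hH, H.apply_symm_apply]
  · have hHx : H ⟨x, hAN hx⟩ = (⟨q x, hAN hx⟩, sheet ⟨x₀, hx₀⟩) :=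
      Prod.ext (Subtype.ext (hH _)) (hsheet ⟨x, hx⟩)
    rw [ContinuousMap.coe_mk, ← hHx, H.symm_apply_apply]

end Lifting

/-! ### Punctured neighbourhoods -/

section Punctured

variable {X Y : Type*} [TopologicalSpace X] [TopologicalSpace Y]

theorem eventually_nhdsNE_map_notMem [T1Space Y] {q : X → Y} {x : X} (hq : ContinuousAt q x)
    (hinj : IsLocallyInjective q) {Z : Set Y} (hZ : Z.Finite) :
    ∀ᶠ y in 𝓝[≠] x, q y ∉ Z := by
  obtain ⟨N, hNo, hxN, hN⟩ := hinj x
  have hclosed : IsClosed (Z \ {q x}) := (hZ.subset sdiff_subset).isClosed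
  filter_upwards [self_mem_nhdsWithin, nhdsWithin_le_nhds (hNo.mem_nhds hxN),
    nhdsWithin_le_nhds (hq (hclosed.isOpen_compl.mem_nhds fun h => h.2 rfl))] with y hyx hyN hy hyZ
  exact hy ⟨hyZ, fun h => hyx (hN hyN hxN h)⟩

theorem map_nhdsNE_of_mem_source (φ : OpenPartialHomeomorph X Y) {x : X} (hx : x ∈ φ.source) :
    map φ (𝓝[≠] x) = 𝓝[≠] (φ x) := by
  have hpre : φ.source ∩ {x}ᶜ = φ.source ∩ φ ⁻¹' {φ x}ᶜ := by
    ext y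
    exact and_congr_right fun hy => (φ.injOn.eq_iff hy hx).not.symm
  rw [← φ.nhdsWithin_source_inter hx, hpre, φ.nhdsWithin_source_inter hx,
    φ.map_nhdsWithin_preimage_eq hx]

variable {E : Type*} [NormedAddCommGroup E]

variable (E) in
theorem map_chartAt_symm_nhdsNE [ChartedSpace E X] (x : X) :
    map (chartAt E x).symm (𝓝[≠] (chartAt E x x)) = 𝓝[≠] x := by
  rw [map_nhdsNE_of_mem_source _ ((chartAt E x).map_source (mem_chart_source E x)),
    (chartAt E x).left_inv (mem_chart_source E x)]

variable [NormedSpace ℝ E]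

theorem isPreconnected_ball_sdiff_center (hE : 1 < Module.rank ℝ E) (c : E) {r : ℝ} (hr : 0 < r) :
    IsPreconnected (Metric.ball c r \ {c}) := by
  let ψ := OpenPartialHomeomorph.univBall c r
  have himg : ψ '' {0}ᶜ = Metric.ball c r \ {c} := by
    have huniv : ψ '' univ = Metric.ball c r := by
      have := ψ.image_source_eq_target
      rwa [OpenPartialHomeomorph.univBall_source, OpenPartialHomeomorph.univBall_target c hr]
        at this
    have hinj : InjOn ψ univ := by
      simpa only [ψ, OpenPartialHomeomorph.univBall_source] using ψ.injOn
    rw [compl_eq_univ_sdiff, hinj.image_sdiff_subset (subset_univ _), huniv, image_singleton,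
      OpenPartialHomeomorph.univBall_apply_zero]
  rw [← himg]
  exact (isConnected_compl_singleton_of_one_lt_rank hE 0).isPreconnected.image _
    (OpenPartialHomeomorph.continuous_univBall c r).continuousOn

variable [ChartedSpace E X]

variable (E) in
theorem nhdsNE_neBot_of_chartedSpace [Nontrivial E] (x : X) : (𝓝[≠] x).NeBot := by
  have := Module.punctured_nhds_neBot ℝ E (chartAt E x x)
  rw [← map_chartAt_symm_nhdsNE E x]
  infer_instance

theorem exists_isPreconnected_mem_nhdsNE (hE : 1 < Module.rank ℝ E) {x : X} {N : Set X}
    (hN : N ∈ 𝓝[≠] x) : ∃ P ∈ 𝓝[≠] x, IsPreconnected P ∧ P ⊆ N := by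
  let φ := chartAt E x
  have htarget : φ.target ∈ 𝓝 (φ x) :=
    φ.open_target.mem_nhds (φ.map_source (mem_chart_source E x))
  rw [← map_chartAt_symm_nhdsNE E x, mem_map] at hN
  obtain ⟨r, hr, hsub⟩ := Metric.mem_nhdsWithin_iff.1 (inter_mem hN (nhdsWithin_le_nhds htarget))
  refine ⟨φ.symm '' (Metric.ball (φ x) r \ {φ x}), ?_, ?_, ?_⟩
  · rw [← map_chartAt_symm_nhdsNE E x]
    exact image_mem_map (sdiff_mem_nhdsWithin_compl (Metric.ball_mem_nhds _ hr) _)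
  · exact (isPreconnected_ball_sdiff_center hE _ hr).image _
      (φ.continuousOn_symm.mono fun y hy => (hsub hy).2)
  · exact image_subset_iff.2 fun y hy => (hsub hy).1

theorem isPreconnected_compl_of_forall_eventually_notMem (hE : 1 < Module.rank ℝ E)
    [PreconnectedSpace X] {Z : Set X} (hZ : ∀ x, ∀ᶠ y in 𝓝[≠] x, y ∉ Z) :
    IsPreconnected Zᶜ := by
  have : Nontrivial E := rank_pos_iff_nontrivial.1 (zero_lt_one.trans hE)
  refine isPreconnected_iff_subset_of_disjoint.2 fun u v hu hv huv hdisj => ?_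
  have hopen : IsOpen (closure (Zᶜ ∩ u)) := isOpen_iff_mem_nhds.2 fun x hx => by
    have := nhdsNE_neBot_of_chartedSpace E x
    obtain ⟨P, hP, hPconn, hPZ⟩ := exists_isPreconnected_mem_nhdsNE hE (hZ x)
    have hmeet : (P ∩ u).Nonempty := by
      obtain ⟨y, hy, -, hyu⟩ := mem_closure_iff_nhds.1 hx _ (insert_mem_nhds_iff.2 hP)
      rcases hy with rfl | hy
      · exact nonempty_of_mem (inter_mem hP (nhdsWithin_le_nhds (hu.mem_nhds hyu)))
      · exact ⟨y, hy, hyu⟩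
    have hPu : P ⊆ u := by
      refine (isPreconnected_iff_subset_of_disjoint.1 hPconn u v hu hv (hPZ.trans huv)
        (subset_empty_iff.1 (hdisj ▸ inter_subset_inter_left _ hPZ))).resolve_right fun hPv => ?_
      obtain ⟨y, hyP, hyu⟩ := hmeet
      exact notMem_empty y (hdisj ▸ ⟨hPZ hyP, hyu, hPv hyP⟩)
    exact mem_of_superset (insert_mem_nhds_iff.2 hP)
      (insert_subset hx ((subset_inter hPZ hPu).trans subset_closure))
  rcases isClopen_iff.1 ⟨isClosed_closure, hopen⟩ with hempty | huniv
  · exact .inr fun x hx => (huv hx).resolve_left fun hxu =>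
      notMem_empty x ((closure_empty_iff _).1 hempty ▸ ⟨hx, hxu⟩)
  · refine .inl fun x hx => (huv hx).resolve_right fun hxv => ?_
    obtain ⟨y, hyv, hyZ, hyu⟩ := mem_closure_iff.1 (huniv ▸ mem_univ x) v hv hxv
    exact notMem_empty y (hdisj ▸ ⟨hyZ, hyu, hyv⟩)

end Punctured

/-! ### Lifts of polar coordinates -/

section PolarLift

variable {X : Type*} [TopologicalSpace X] {q : X → OnePoint ℂ} {a : OnePoint ℂ} {ρ : ℝ}
  {F F' : C(polarDisk ρ, X)}

/-- `F` lifts the polar coordinates around `a` through `q`: it parametrises a piece of `X` by a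
half-plane in such a way that `q` becomes an exponential map. -/
def IsPolarLift (q : X → OnePoint ℂ) (a : OnePoint ℂ) (F : C(polarDisk ρ, X)) : Prop :=
  ∀ z, q (F z) = polar a z

/-- The deck transformations of the polar coordinates on the disk of radius `ρ`. -/
def polarShift (n : ℤ) : C(polarDisk ρ, polarDisk ρ) where
  toFun z := ⟨z + n * (2 * Real.pi * Complex.I), by
    rw [← polar_mem_sphericalDisk (a := ∞), polar_add_int_mul, polar_mem_sphericalDisk]
    exact z.2⟩

/-- Every point of `X` that lies over a point with polar coordinates around `a` is reached by a
lift of these coordinates over the whole disk of radius `ρ`. -/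
def HasPolarLifts (q : X → OnePoint ℂ) (a : OnePoint ℂ) (ρ : ℝ) : Prop :=
  ∀ x, q x ∈ range (polar a) → ∃ F : C(polarDisk ρ, X), IsPolarLift q a F ∧ x ∈ range F

theorem hasPolarLifts_of_forall_exists_path_lift [T2Space X] (hq : IsLocalHomeomorph q)
    (hD : ∀ x, q x ∈ sphericalDisk a ρ)
    (hlift : ∀ (γ : C(I, OnePoint ℂ)) (x : X),
      (∀ t, γ t ∈ sphericalDisk a ρ ∩ range (polar a)) → q x = γ 0 →
      ∃ Γ : C(I, X), Γ 0 = x ∧ ∀ t, q (Γ t) = γ t) :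
    HasPolarLifts q a ρ := by
  rintro x ⟨z, hz⟩
  have hzρ : z ∈ polarDisk ρ := polar_mem_sphericalDisk.1 (hz ▸ hD x)
  obtain ⟨F, hFx, hF⟩ := exists_lift_of_convex (convex_polarDisk ρ) (z₀ := ⟨z, hzρ⟩) hq
    ⟨fun z => polar a z, (continuous_polar a).comp continuous_subtype_val⟩ hz.symm
    fun γ hγ => hlift γ x fun t => by
      obtain ⟨w, hw⟩ := hγ t
      exact hw ▸ ⟨polar_mem_sphericalDisk.2 w.2, mem_range_self _⟩
  exact ⟨F, hF, _, hFx⟩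

namespace IsPolarLift

theorem comp_polarShift (hF : IsPolarLift q a F) (n : ℤ) :
    IsPolarLift q a (F.comp (polarShift n)) := fun z =>
  (hF _).trans (polar_add_int_mul a z n)

theorem isOpenMap (hq : IsLocalHomeomorph q) (hF : IsPolarLift q a F) : IsOpenMap F := by
  have hcomp : IsLocalHomeomorph (q ∘ F) := by
    rw [show q ∘ F = polar a ∘ Subtype.val from funext hF]
    exact (isLocalHomeomorph_polar a).comp
      (isOpen_polarDisk ρ).isOpenEmbedding_subtypeVal.isLocalHomeomorph
  exact (hcomp.of_comp hq F.continuous).isOpenMap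

theorem exists_eq_comp_polarShift [T2Space X] (hq : IsLocalHomeomorph q) (hF : IsPolarLift q a F)
    (hF' : IsPolarLift q a F') {z w : polarDisk ρ} (h : F z = F' w) :
    ∃ n, z = polarShift n w ∧ F' = F.comp (polarShift n) := by
  obtain ⟨n, hn⟩ := polar_eq_polar_iff.1 ((hF z).symm.trans ((congrArg q h).trans (hF' w)))
  have hz : z = polarShift n w := Subtype.ext hn
  have := isPreconnected_iff_preconnectedSpace.1 (convex_polarDisk ρ).isPreconnected
  refine ⟨n, hz, DFunLike.coe_injective ?_⟩
  exact (T2Space.isSeparatedMap q).eq_of_comp_eq hq.isLocallyInjective F'.continuous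
    (F.comp _).continuous (funext fun v => (hF' v).trans (hF.comp_polarShift n v).symm) w
    (by rw [← h, hz, ContinuousMap.comp_apply])

theorem range_eq [T2Space X] (hq : IsLocalHomeomorph q) (hlifts : HasPolarLifts q a ρ)
    (hconn : IsPreconnected (q ⁻¹' range (polar a))) (hρ : 0 < ρ) (hF : IsPolarLift q a F) :
    range F = q ⁻¹' range (polar a) := by
  let others : Set (C(polarDisk ρ, X)) :=
    {F' | IsPolarLift q a F' ∧ Disjoint (range F) (range F')}
  have hothers : IsOpen (⋃ F' ∈ others, range F') := isOpen_biUnion fun F' hF' =>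
    (isOpenMap hq (mem_ofPred_eq ▸ hF').1).isOpen_range
  have hdisj : Disjoint (range F) (⋃ F' ∈ others, range F') :=
    disjoint_iUnion₂_right.2 fun F' hF' => hF'.2
  have hcover : q ⁻¹' range (polar a) ⊆ range F ∪ ⋃ F' ∈ others, range F' := fun x hx => by
    obtain ⟨F', hF', hxF'⟩ := hlifts x hx
    by_cases hmeet : Disjoint (range F) (range F')
    · exact .inr (mem_biUnion (show F' ∈ others from ⟨hF', hmeet⟩) hxF')
    · obtain ⟨-, ⟨z, rfl⟩, w, hw⟩ := not_disjoint_iff.1 hmeet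
      obtain ⟨n, -, rfl⟩ := hF.exists_eq_comp_polarShift hq hF' hw.symm
      exact .inl (range_comp_subset_range _ F hxF')
  have hsub : range F ⊆ q ⁻¹' range (polar a) :=
    range_subset_iff.2 fun z => ⟨z, (hF z).symm⟩
  obtain ⟨z, hz⟩ := nonempty_polarDisk hρ
  exact hsub.antisymm (hconn.subset_left_of_subset_union (hF.isOpenMap hq).isOpen_range
    hothers hdisj hcover ⟨F ⟨z, hz⟩, hsub (mem_range_self _), mem_range_self _⟩)

theorem isPreconnected_preimage (hF : IsPolarLift q a F)
    (hrange : range F = q ⁻¹' range (polar a)) (r : ℝ) :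
    IsPreconnected (q ⁻¹' (sphericalDisk a r ∩ range (polar a))) := by
  have himage : F '' (Subtype.val ⁻¹' polarDisk r) =
      q ⁻¹' (sphericalDisk a r ∩ range (polar a)) := by
    rw [preimage_inter, ← hrange, ← image_univ, ← image_preimage_inter, inter_univ]
    congr 1
    ext z
    rw [mem_preimage, mem_preimage, mem_preimage, hF, polar_mem_sphericalDisk]
  rw [← himage]
  refine IsPreconnected.image ?_ F F.continuous.continuousOn
  rw [← IsInducing.subtypeVal.isPreconnected_image, Subtype.image_preimage_coe]
  exact ((convex_polarDisk ρ).inter (convex_polarDisk r)).isPreconnected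

theorem isCompact_sphericalDist_eq [T2Space X] (hq : IsLocalHomeomorph q) (hF : IsPolarLift q a F)
    (hsurj : Function.Surjective F) (hinj : ¬ Function.Injective F) (r : ℝ) :
    IsCompact {x | sphericalDist (q x) a = r} := by
  obtain ⟨z, w, hzw, hne⟩ := Function.not_injective_iff.1 hinj
  obtain ⟨n, hz, hn⟩ := hF.exists_eq_comp_polarShift hq hF hzw
  have hn0 : n ≠ 0 := by
    rintro rfl
    exact hne (hz.trans (Subtype.ext (by simp [polarShift])))
  rcases {x | sphericalDist (q x) a = r}.eq_empty_or_nonempty with hempty | ⟨x, hx⟩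
  · exact hempty ▸ isCompact_empty
  obtain ⟨z₀, rfl⟩ := hsurj x
  let vertical (θ : ℝ) : polarDisk ρ := ⟨z₀ + θ * Complex.I, by simpa [polarDisk] using z₀.2⟩
  have hper : Function.Periodic (F ∘ vertical) (n * (2 * Real.pi)) := fun θ => by
    have hshift : vertical (θ + n * (2 * Real.pi)) = polarShift n (vertical θ) := Subtype.ext <| by
      simp only [vertical, polarShift, ContinuousMap.coe_mk]
      push_cast
      ring
    rw [Function.comp_apply, hshift]
    exact (DFunLike.congr_fun hn (vertical θ)).symm
  have hlevel : ∀ v, sphericalDist (q (F v)) a = r ↔ (v : ℂ).re = (z₀ : ℂ).re := fun v => by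
    rw [← show sphericalDist (q (F z₀)) a = r from hx, hF, hF, sphericalDist_polar,
      sphericalDist_polar]
    simp [Real.arctan_injective.eq_iff]
  have hrange : range (F ∘ vertical) = {x | sphericalDist (q x) a = r} := by
    have hsub : range (F ∘ vertical) ⊆ {x | sphericalDist (q x) a = r} :=
      range_subset_iff.2 fun θ => (hlevel (vertical θ)).2 (by simp [vertical])
    refine hsub.antisymm fun y hy => ?_
    obtain ⟨v, rfl⟩ := hsurj y
    refine ⟨(v : ℂ).im - (z₀ : ℂ).im, congrArg F (Subtype.ext (Complex.ext ?_ ?_))⟩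
    · simpa [vertical] using ((hlevel v).1 hy).symm
    · simp [vertical]
  rw [← hrange]
  exact hper.compact_of_continuous (by positivity) (F.continuous.comp (by fun_prop))

theorem isHomeomorph (hq : IsLocalHomeomorph q) (hF : IsPolarLift q a F)
    (hbij : Function.Bijective F) : IsHomeomorph F :=
  ⟨F.continuous, hF.isOpenMap hq, hbij⟩

theorem simplyConnectedSpace (hq : IsLocalHomeomorph q) (hF : IsPolarLift q a F)
    (hbij : Function.Bijective F) (hρ : 0 < ρ) : SimplyConnectedSpace X := by
  have := (convex_polarDisk ρ).contractibleSpace (nonempty_polarDisk hρ)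
  have := (hF.isHomeomorph hq hbij).homeomorph.symm.contractibleSpace
  infer_instance

theorem isCoveringMap_codRestrict (hq : IsLocalHomeomorph q) (hF : IsPolarLift q a F)
    (hbij : Function.Bijective F) (hρ : ρ ≤ Real.pi)
    (hmaps : ∀ x, q x ∈ sphericalDisk a ρ \ {a}) :
    IsCoveringMap (codRestrict q (sphericalDisk a ρ \ {a}) hmaps) := by
  have hpre : polarDisk ρ = polar a ⁻¹' (sphericalDisk a ρ \ {a}) := by
    ext z
    exact ⟨fun hz => ⟨polar_mem_sphericalDisk.2 hz, polar_ne a z⟩,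
      fun hz => polar_mem_sphericalDisk.1 hz.1⟩
  have hcov := ((isCoveringMapOn_polar a).mono
    (sphericalDisk_sdiff_center_subset_range_polar hρ)).isCoveringMap_restrictPreimage
  let τ := (hF.isHomeomorph hq hbij).homeomorph.symm.trans (Homeomorph.setCongr hpre)
  convert hcov.comp_homeomorph τ using 1
  ext x
  obtain ⟨z, rfl⟩ := hbij.surjective x
  have hτ : (τ (F z) : ℂ) = z := congrArg Subtype.val
    ((hF.isHomeomorph hq hbij).homeomorph.symm_apply_apply z)
  exact (hF z).trans (congrArg (polar a) hτ.symm)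

end IsPolarLift

theorem isPreconnected_preimage_range_polar [ChartedSpace ℂ X] [PreconnectedSpace X]
    (hq : IsLocalHomeomorph q) (a : OnePoint ℂ) : IsPreconnected (q ⁻¹' range (polar a)) := by
  rw [range_polar, preimage_compl]
  exact isPreconnected_compl_of_forall_eventually_notMem (E := ℂ) (by simp) fun x =>
    eventually_nhdsNE_map_notMem hq.continuous.continuousAt hq.isLocallyInjective
      ((finite_singleton _).insert a)

namespace HasPolarLifts

theorem exists_isPolarLift [T2Space X] [ChartedSpace ℂ X] [ConnectedSpace X]
    (hq : IsLocalHomeomorph q) (h : HasPolarLifts q a ρ) (hρ : 0 < ρ) :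
    ∃ F : C(polarDisk ρ, X), IsPolarLift q a F ∧ range F = q ⁻¹' range (polar a) := by
  obtain ⟨x, hx⟩ := ((dense_range_polar a).preimage hq.isOpenMap).nonempty
  obtain ⟨F, hF, -⟩ := h x hx
  exact ⟨F, hF, hF.range_eq hq h (isPreconnected_preimage_range_polar hq a) hρ⟩

theorem isPreconnected_preimage_sphericalDisk [T2Space X] [ChartedSpace ℂ X] [ConnectedSpace X]
    (hq : IsLocalHomeomorph q) (h : HasPolarLifts q a ρ) (hρ : 0 < ρ) (r : ℝ) :
    IsPreconnected (q ⁻¹' sphericalDisk a r) := by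
  obtain ⟨F, hF, hrange⟩ := h.exists_isPolarLift hq hρ
  exact (hF.isPreconnected_preimage hrange r).subset_closure (preimage_mono inter_subset_left)
    (((dense_range_polar a).preimage hq.isOpenMap).open_subset_closure_inter
      ((isOpen_sphericalDisk a r).preimage hq.continuous))

end HasPolarLifts

end PolarLift

/-! ### Local behaviour of meromorphic functions -/

section LocalInjectivity

variable {g : ℂ → ℂ} {w : ℂ} {s : Set ℂ}

theorem not_eventually_eq_of_injOn (hs : s ∈ 𝓝 w) (hinj : InjOn g s) :
    ¬ ∀ᶠ z in 𝓝 w, g z = g w := fun h => by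
  obtain ⟨z, ⟨hzs, hzw⟩, hne⟩ := Filter.nonempty_of_mem
    (inter_mem (nhdsWithin_le_nhds (inter_mem hs h)) (self_mem_nhdsWithin (s := {w}ᶜ)))
  exact hne (hinj hzs (mem_of_mem_nhds hs) hzw)

theorem eventually_deriv_ne_zero_of_injOn (hg : AnalyticAt ℂ g w) (hs : s ∈ 𝓝 w)
    (hinj : InjOn g s) : ∀ᶠ z in 𝓝[≠] w, deriv g z ≠ 0 := by
  refine (hg.deriv.eventually_eq_zero_or_eventually_ne_zero).resolve_left fun h =>
    not_eventually_eq_of_injOn hs hinj ?_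
  obtain ⟨ε, hε, hball⟩ := Metric.eventually_nhds_iff_ball.1 (hg.eventually_analyticAt.and h)
  filter_upwards [Metric.ball_mem_nhds w hε] with z hz
  exact Metric.isOpen_ball.is_const_of_deriv_eq_zero (convex_ball w ε).isPreconnected
    (fun v hv => (hball v hv).1.differentiableAt.differentiableWithinAt)
    (fun v hv => (hball v hv).2) hz (Metric.mem_ball_self hε)

theorem exists_openPartialHomeomorph_of_injOn (hs : IsOpen s) (hg : AnalyticOnNhd ℂ g s)
    (hinj : InjOn g s) : ∃ φ : OpenPartialHomeomorph ℂ ℂ, φ.source = s ∧ φ = g := by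
  have hopen : IsOpenMap (s.domRestrict g) := isOpenMap_iff_nhds_le.2 fun z => by
    rw [domRestrict_eq, Function.comp_apply, ← map_map,
      map_nhds_subtype_coe_eq_nhds z.2 (hs.mem_nhds z.2)]
    exact (hg z z.2).eventually_constant_or_nhds_le_map_nhds.resolve_left
      (not_eventually_eq_of_injOn (hs.mem_nhds z.2) hinj)
  exact ⟨.ofContinuousOpenRestrict (hinj.toPartialEquiv g s) hg.continuousOn hopen hs, rfl, rfl⟩

-- The local inverse is differentiable off `g w`, hence at `g w` by the removable singularity
-- theorem, so that the chain rule applies at `w`.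
theorem deriv_ne_zero_of_injOn (hg : AnalyticAt ℂ g w) (hs : s ∈ 𝓝 w) (hinj : InjOn g s) :
    deriv g w ≠ 0 := by
  obtain ⟨B, hB, hBo, hwB⟩ := eventually_nhds_iff.1 (hg.eventually_analyticAt.and
    ((eventually_nhdsWithin_iff.1 (eventually_deriv_ne_zero_of_injOn hg hs hinj)).and hs))
  obtain ⟨φ, hφB, rfl⟩ := exists_openPartialHomeomorph_of_injOn hBo (fun z hz => (hB z hz).1)
    (hinj.mono fun z hz => (hB z hz).2.2)
  subst hφB
  have hφw : φ w ∈ φ.target := φ.map_source hwB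
  have hdiff : DifferentiableOn ℂ φ.symm φ.target := by
    refine (Complex.differentiableOn_compl_singleton_and_continuousAt_iff
      (φ.open_target.mem_nhds hφw)).1 ⟨fun v hv => ?_, φ.continuousAt_symm hφw⟩
    obtain ⟨han, hderiv, -⟩ := hB _ (φ.map_target hv.1)
    have hvw : φ.symm v ≠ w := fun h => hv.2 (by rw [mem_singleton_iff, ← h, φ.right_inv hv.1])
    exact (φ.hasDerivAt_symm hv.1 (hderiv hvw)
      han.differentiableAt.hasDerivAt).differentiableAt.differentiableWithinAt
  have hcomp : HasDerivAt (φ.symm ∘ φ) (deriv φ.symm (φ w) * deriv φ w) w :=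
    (hdiff.differentiableAt (φ.open_target.mem_nhds hφw)).hasDerivAt.comp w
      hg.differentiableAt.hasDerivAt
  have hid : HasDerivAt (φ.symm ∘ φ) 1 w :=
    (hasDerivAt_id w).congr_of_eventuallyEq (φ.eventually_left_inverse hwB)
  exact right_ne_zero_of_mul (hcomp.unique hid ▸ one_ne_zero)

end LocalInjectivity

section LocalExpr

variable {M : Type*} [TopologicalSpace M] [ChartedSpace ℂ M] {Ψ : M → OnePoint ℂ} {p : M}

theorem IsLocalExpr.exists_isOpenEmbedding {g : ℂ → ℂ} (h : IsLocalExpr Ψ p g) :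
    ∃ c : ℂ → OnePoint ℂ, IsOpenEmbedding c ∧ ∀ᶠ x in 𝓝 p, Ψ x = c (g (chartAt ℂ p x)) :=
  h.2.elim (fun h => ⟨_, OnePoint.isOpenEmbedding_coe, h⟩) fun h => ⟨_, isOpenEmbedding_recip, h⟩

theorem continuousAt_chartAt (p : M) : ContinuousAt (chartAt ℂ p) p :=
  (chartAt ℂ p).continuousAt (mem_chart_source ℂ p)

theorem IsMeromorphicAt.continuousAt (h : IsMeromorphicAt Ψ p) : ContinuousAt Ψ p := by
  obtain ⟨g, hg⟩ := h
  obtain ⟨c, hc, hΨ⟩ := hg.exists_isOpenEmbedding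
  exact (hc.continuous.continuousAt.comp
    (hg.1.continuousAt.comp (continuousAt_chartAt p))).congr (EventuallyEq.symm hΨ)

theorem IsMeromorphicAt.eventually_eq_or_eventually_ne (h : IsMeromorphicAt Ψ p) :
    (∀ᶠ x in 𝓝 p, Ψ x = Ψ p) ∨ ∀ᶠ x in 𝓝[≠] p, Ψ x ≠ Ψ p := by
  obtain ⟨g, hg⟩ := h
  obtain ⟨c, hc, hΨ⟩ := hg.exists_isOpenEmbedding
  have hp := hΨ.self_of_nhds
  refine (hg.1.eventually_eq_or_eventually_ne (analyticAt_const (v := g (chartAt ℂ p p)))).imp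
    (fun h => ?_) fun h => ?_
  · filter_upwards [hΨ, (continuousAt_chartAt p).eventually h] with x hx hgx
    rw [hx, hp, hgx]
  · rw [← map_nhdsNE_of_mem_source (chartAt ℂ p) (mem_chart_source ℂ p)] at h
    filter_upwards [nhdsWithin_le_nhds hΨ, h] with x hx hgx
    rw [hx, hp]
    exact hc.injective.ne hgx

theorem eq_of_isPreconnected_of_eventually_eq {A : Set M}
    (hA : IsPreconnected A) (hΨ : ∀ y ∈ A, IsMeromorphicAt Ψ y) (hp : p ∈ A)
    (h : ∀ᶠ x in 𝓝 p, Ψ x = Ψ p) {y : M} (hy : y ∈ A) : Ψ y = Ψ p := by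
  let Z : Set M := {y | ∀ᶠ z in 𝓝 y, Ψ z = Ψ p}
  have hZeq : ∀ z ∈ Z, Ψ z = Ψ p := fun z (hz : ∀ᶠ y in 𝓝 z, Ψ y = Ψ p) => hz.self_of_nhds
  refine hZeq y (hA.subset_of_closure_inter_subset isOpen_setOfPred_eventually_nhds
    ⟨p, hp, h⟩ ?_ hy)
  rintro y ⟨hyZ, hyA⟩
  have hyp : Ψ y = Ψ p := by
    by_contra hne
    obtain ⟨z, hz, hzZ⟩ := mem_closure_iff_nhds.1 hyZ _
      ((hΨ y hyA).continuousAt (isOpen_ne.mem_nhds hne))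
    exact hz (hZeq z hzZ)
  rcases (hΨ y hyA).eventually_eq_or_eventually_ne with h' | h'
  · exact h'.mono fun z hz => hz.trans hyp
  · by_contra hy
    obtain ⟨z, hz, hzZ⟩ := mem_closure_iff_nhds.1 hyZ _ (eventually_nhdsWithin_iff.1 h')
    exact hz (fun hzy => hy (hzy ▸ hzZ)) ((hZeq z hzZ).trans hyp.symm)

theorem IsMeromorphicAt.exists_openPartialHomeomorph (h : IsMeromorphicAt Ψ p)
    (hp : ¬ IsCriticalPoint Ψ p) :
    ∃ φ : OpenPartialHomeomorph M (OnePoint ℂ), p ∈ φ.source ∧ EqOn Ψ φ φ.source := by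
  obtain ⟨g, hg⟩ := h
  have hderiv : deriv g (chartAt ℂ p p) ≠ 0 := fun h0 => hp ⟨g, hg, h0⟩
  obtain ⟨c, hc, hΨ⟩ := hg.exists_isOpenEmbedding
  obtain ⟨W, hW, hWo, hpW⟩ := eventually_nhds_iff.1 hΨ
  have hstrict := hg.1.hasStrictDerivAt.hasStrictFDerivAt_equiv hderiv
  let φ := (((chartAt ℂ p).trans hstrict.toOpenPartialHomeomorph).trans
    (hc.toOpenPartialHomeomorph c)).restrOpen W hWo
  refine ⟨φ, ?_, fun x hx => hW x hx.2⟩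
  simp [φ, hpW, hstrict.mem_toOpenPartialHomeomorph_source]

theorem IsLocalExpr.deriv_ne_zero_of_injOn {g : ℂ → ℂ} (h : IsLocalExpr Ψ p g) {N : Set M}
    (hN : N ∈ 𝓝 p) (hinj : InjOn Ψ N) : deriv g (chartAt ℂ p p) ≠ 0 := by
  obtain ⟨c, -, hΨ⟩ := h.exists_isOpenEmbedding
  have hp := mem_chart_target ℂ p
  have hsymm : Tendsto (chartAt ℂ p).symm (𝓝 (chartAt ℂ p p)) (𝓝 p) :=
    (chartAt ℂ p).tendsto_symm (mem_chart_source ℂ p)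
  refine InverseSingularity.deriv_ne_zero_of_injOn h.1 (inter_mem
    ((chartAt ℂ p).open_target.mem_nhds hp) (hsymm (inter_mem hN hΨ))) ?_
  rintro v ⟨hv, hvN, hvΨ⟩ w ⟨hw, hwN, hwΨ⟩ hvw
  refine (chartAt ℂ p).symm.injOn hv hw (hinj hvN hwN ?_)
  calc Ψ ((chartAt ℂ p).symm v) = c (g (chartAt ℂ p ((chartAt ℂ p).symm v))) := hvΨ
    _ = c (g (chartAt ℂ p ((chartAt ℂ p).symm w))) := by
      rw [(chartAt ℂ p).right_inv hv, (chartAt ℂ p).right_inv hw, hvw]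
    _ = Ψ ((chartAt ℂ p).symm w) := hwΨ.symm

theorem not_isCriticalPoint_of_injOn {N : Set M} (hN : N ∈ 𝓝 p) (hinj : InjOn Ψ N) :
    ¬ IsCriticalPoint Ψ p :=
  fun ⟨_, hg, hderiv⟩ => hg.deriv_ne_zero_of_injOn hN hinj hderiv

end LocalExpr

section Component

variable {M : Type*} {Ψ : M → OnePoint ℂ} {e p : M}

theorem mem_diskPreimage_self (hp : p ≠ e) {ρ : ℝ} (hρ : 0 < ρ) :
    p ∈ diskPreimage Ψ e (Ψ p) ρ :=
  ⟨hp, mem_sphericalDisk_self _ hρ⟩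

theorem diskPreimage_mono (Ψ : M → OnePoint ℂ) (e : M) (a : OnePoint ℂ) :
    Monotone (diskPreimage Ψ e a) :=
  fun _ _ h _ hx => ⟨hx.1, sphericalDisk_mono a h hx.2⟩

theorem isOpen_diskPreimage [TopologicalSpace M] [T1Space M]
    (hΨ : ∀ x, x ≠ e → ContinuousAt Ψ x) (a : OnePoint ℂ) (ρ : ℝ) :
    IsOpen (diskPreimage Ψ e a ρ) :=
  isOpen_iff_mem_nhds.2 fun x ⟨hx, hxD⟩ => inter_mem (isOpen_ne.mem_nhds hx)
    ((hΨ x hx).eventually ((isOpen_sphericalDisk a ρ).mem_nhds hxD))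

theorem exists_connectedComponentIn_diskPreimage_subset [TopologicalSpace M] [T2Space M]
    [LocallyCompactSpace M] (hΨ : ∀ x, x ≠ e → ContinuousAt Ψ x) (hp : p ≠ e)
    (hiso : ∀ᶠ x in 𝓝[≠] p, Ψ x ≠ Ψ p) {N : Set M} (hN : N ∈ 𝓝 p) :
    ∃ ρ > 0, connectedComponentIn (diskPreimage Ψ e (Ψ p) ρ) p ⊆ N := by
  obtain ⟨W, hW, hWo, hpW⟩ := eventually_nhds_iff.1 ((eventually_mem_set.2 hN).and
    ((isOpen_ne.eventually_mem hp).and (eventually_nhdsWithin_iff.1 hiso)))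
  obtain ⟨V, hVo, hpV, hVW, hVc⟩ := exists_open_between_and_isCompact_closure
    isCompact_singleton hWo (singleton_subset_iff.2 hpW)
  rw [singleton_subset_iff] at hpV
  have hfrW : frontier V ⊆ W := frontier_subset_closure.trans hVW
  have himg : IsCompact (Ψ '' frontier V) :=
    (hVc.of_isClosed_subset isClosed_frontier frontier_subset_closure).image_of_continuousOn
      fun x hx => (hΨ x (hW x (hfrW hx)).2.1).continuousWithinAt
  have hnot : Ψ p ∉ Ψ '' frontier V := by
    rintro ⟨x, hx, hxp⟩
    refine (hW x (hfrW hx)).2.2 ?_ hxp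
    rintro rfl
    exact (hVo.frontier_eq ▸ hx).2 hpV
  obtain ⟨ρ, hρ, hsub⟩ := exists_sphericalDisk_subset (himg.isClosed.isOpen_compl.mem_nhds hnot)
  refine ⟨ρ, hρ, Subset.trans ?_ (subset_closure.trans (hVW.trans fun x hx => (hW x hx).1))⟩
  refine isPreconnected_connectedComponentIn.subset_of_closure_inter_subset hVo
    ⟨p, mem_connectedComponentIn (mem_diskPreimage_self hp hρ), hpV⟩ ?_
  rintro x ⟨hx, hxT⟩
  by_contra hxV
  exact hsub (connectedComponentIn_subset _ _ hxT).2
    ⟨x, by rw [hVo.frontier_eq]; exact ⟨hx, hxV⟩, rfl⟩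

end Component

/-! ### Branches of the inverse function -/

namespace Branch

section

variable {M : Type*} [TopologicalSpace M] {Ψ : M → OnePoint ℂ} {e : M} (U V : Branch Ψ e)
  {ρ ρ' : Ioi (0 : ℝ)}

theorem nbhd_nonempty (ρ : Ioi (0 : ℝ)) : (U.nbhd ρ).Nonempty := by
  obtain ⟨z, hz, h⟩ := U.isComponent ρ
  exact ⟨z, h ▸ mem_connectedComponentIn hz⟩

theorem nbhd_subset (ρ : Ioi (0 : ℝ)) : U.nbhd ρ ⊆ diskPreimage Ψ e U.value ρ := by
  obtain ⟨z, -, h⟩ := U.isComponent ρ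
  exact h ▸ connectedComponentIn_subset _ _

theorem isPreconnected_nbhd (ρ : Ioi (0 : ℝ)) : IsPreconnected (U.nbhd ρ) := by
  obtain ⟨z, -, h⟩ := U.isComponent ρ
  exact h ▸ isPreconnected_connectedComponentIn

theorem nbhd_eq {z : M} (hz : z ∈ U.nbhd ρ) :
    U.nbhd ρ = connectedComponentIn (diskPreimage Ψ e U.value ρ) z := by
  obtain ⟨w, hw, h⟩ := U.isComponent ρ
  rw [h] at hz ⊢
  exact connectedComponentIn_eq hz

theorem subset_nbhd {A : Set M} (hA : IsPreconnected A) (hsub : A ⊆ diskPreimage Ψ e U.value ρ)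
    (h : (A ∩ U.nbhd ρ).Nonempty) : A ⊆ U.nbhd ρ := by
  obtain ⟨z, hzA, hz⟩ := h
  rw [U.nbhd_eq hz]
  exact hA.subset_connectedComponentIn hzA hsub

theorem nbhd_subset_nbhd (hD : sphericalDisk V.value ρ' ⊆ sphericalDisk U.value ρ)
    (h : (V.nbhd ρ' ∩ U.nbhd ρ).Nonempty) : V.nbhd ρ' ⊆ U.nbhd ρ :=
  U.subset_nbhd (V.isPreconnected_nbhd ρ')
    (fun _ hx => ⟨(V.nbhd_subset ρ' hx).1, hD (V.nbhd_subset ρ' hx).2⟩) h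

theorem isOpen_nbhd [LocallyConnectedSpace M] [T1Space M] (hΨ : ∀ x, x ≠ e → ContinuousAt Ψ x)
    (ρ : Ioi (0 : ℝ)) : IsOpen (U.nbhd ρ) := by
  obtain ⟨z, -, h⟩ := U.isComponent ρ
  exact h ▸ (isOpen_diskPreimage hΨ _ _).connectedComponentIn

theorem mem_nbhd_of_mem_closure [LocallyConnectedSpace M] [T1Space M]
    (hΨ : ∀ x, x ≠ e → ContinuousAt Ψ x) {x : M} (hx : x ∈ closure (U.nbhd ρ))
    (hxD : x ∈ diskPreimage Ψ e U.value ρ) : x ∈ U.nbhd ρ := by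
  have hopen := (isOpen_diskPreimage hΨ U.value ρ).connectedComponentIn (x := x)
  refine U.subset_nbhd isPreconnected_connectedComponentIn (connectedComponentIn_subset _ _) ?_
    (mem_connectedComponentIn hxD)
  exact mem_closure_iff.1 hx _ hopen (mem_connectedComponentIn hxD)

variable {U V} in
theorem eq_of_forall_meet (hv : V.value = U.value)
    (h : ∀ ρ : Ioi (0 : ℝ), ∃ ρ' ≤ ρ, (V.nbhd ρ' ∩ U.nbhd ρ').Nonempty) : V = U := by
  refine Branch.ext hv (funext fun ρ => ?_)
  obtain ⟨ρ', hle, z, hzV, hzU⟩ := h ρ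
  rw [V.nbhd_eq (V.mono hle hzV), U.nbhd_eq (U.mono hle hzU), hv]

/-- The branch of `Ψ⁻¹` at an ordinary or critical point `p`: over the value `Ψ p`, it picks the
components that contain `p`. -/
def ofPoint (Ψ : M → OnePoint ℂ) {p : M} (hp : p ≠ e) : Branch Ψ e where
  value := Ψ p
  nbhd ρ := connectedComponentIn (diskPreimage Ψ e (Ψ p) ρ) p
  isComponent ρ := ⟨p, mem_diskPreimage_self hp ρ.2, rfl⟩
  mono _ _ h := connectedComponentIn_mono _ (diskPreimage_mono Ψ e _ h)

theorem mem_nbhd_ofPoint {p : M} (hp : p ≠ e) (ρ : Ioi (0 : ℝ)) : p ∈ (ofPoint Ψ hp).nbhd ρ :=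
  mem_connectedComponentIn (mem_diskPreimage_self hp ρ.2)

theorem exists_branch_of_tendsto {c : ℝ → M} {t : ℝ} (ht : 0 < t) (hc : ContinuousOn c (Ico 0 t))
    (hce : ∀ s ∈ Ico 0 t, c s ≠ e) {b : OnePoint ℂ} (hb : Tendsto (Ψ ∘ c) (𝓝[<] t) (𝓝 b)) :
    ∃ V : Branch Ψ e, V.value = b ∧ ∀ ρ, ∀ᶠ s in 𝓝[<] t, c s ∈ V.nbhd ρ := by
  have hex : ∀ ρ : Ioi (0 : ℝ), ∃ T ∈ Ico 0 t, ∀ s ∈ Ico T t, c s ∈ diskPreimage Ψ e b ρ := by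
    intro ρ
    have h1 : ∀ᶠ s in 𝓝[<] t, Ψ (c s) ∈ sphericalDisk b ρ :=
      hb ((isOpen_sphericalDisk b ρ).mem_nhds (mem_sphericalDisk_self b ρ.2))
    obtain ⟨l, hl, hls⟩ := mem_nhdsLT_iff_exists_Ico_subset.1 h1
    have hl' : l < t := hl
    refine ⟨max l 0, ⟨le_max_right _ _, max_lt hl' ht⟩,
      fun s hs => ⟨hce s ⟨?_, hs.2⟩, hls ⟨?_, hs.2⟩⟩⟩
    · exact (le_max_right _ _).trans hs.1
    · exact (le_max_left _ _).trans hs.1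
  choose T hT hTs using hex
  have hmem : ∀ ρ, ∀ s ∈ Ico (T ρ) t,
      c s ∈ connectedComponentIn (diskPreimage Ψ e b ρ) (c (T ρ)) := by
    intro ρ s hs
    have hpre : IsPreconnected (c '' Ico (T ρ) t) :=
      isPreconnected_Ico.image _ (hc.mono (Ico_subset_Ico_left (hT ρ).1))
    exact hpre.subset_connectedComponentIn ⟨T ρ, left_mem_Ico.2 (hT ρ).2, rfl⟩
      (by rintro _ ⟨u, hu, rfl⟩; exact hTs ρ u hu) ⟨s, hs, rfl⟩
  refine ⟨⟨b, fun ρ => connectedComponentIn (diskPreimage Ψ e b ρ) (c (T ρ)),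
    fun ρ => ⟨c (T ρ), hTs ρ _ (left_mem_Ico.2 (hT ρ).2), rfl⟩, fun ρ ρ' h => ?_⟩, rfl,
    fun ρ => ?_⟩
  · have hu : max (T ρ) (T ρ') < t := max_lt (hT ρ).2 (hT ρ').2
    have h1 := hmem ρ (max (T ρ) (T ρ')) ⟨le_max_left _ _, hu⟩
    have h2 := hmem ρ' (max (T ρ) (T ρ')) ⟨le_max_right _ _, hu⟩
    beta_reduce
    rw [connectedComponentIn_eq h1, connectedComponentIn_eq h2]
    exact connectedComponentIn_mono _ (diskPreimage_mono Ψ e b h)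
  · exact mem_of_superset (Ico_mem_nhdsLT (hT ρ).2) (hmem ρ)

variable {U}

theorem IsTranscendental.exists_ne (hU : U.IsTranscendental) (ρ : Ioi (0 : ℝ)) :
    ∃ x ∈ U.nbhd ρ, Ψ x ≠ U.value := by
  by_contra! h
  obtain ⟨x, hx⟩ := U.nbhd_nonempty ρ
  refine Set.notMem_empty x (Eq.subset hU (mem_iInter.2 fun ρ' => ?_))
  obtain ⟨y, hy⟩ := U.nbhd_nonempty (min ρ ρ')
  refine U.subset_nbhd (U.isPreconnected_nbhd ρ) (fun z hz => ⟨(U.nbhd_subset ρ hz).1, ?_⟩)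
    ⟨y, U.mono (min_le_left _ _) hy, U.mono (min_le_right _ _) hy⟩ hx
  exact (h z hz).symm ▸ mem_sphericalDisk_self _ ρ'.2

theorem eq_value_of_forall_mem {x : M} (h : ∀ ρ, x ∈ U.nbhd ρ) : Ψ x = U.value :=
  eq_of_forall_mem_sphericalDisk fun ρ hρ => (U.nbhd_subset ⟨ρ, hρ⟩ (h ⟨ρ, hρ⟩)).2

theorem IsTranscendental.eventually_ne [ChartedSpace ℂ M]
    (hΨ : ∀ p, p ≠ e → IsMeromorphicAt Ψ p) (hU : U.IsTranscendental) {x : M}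
    (hx : x ∈ U.nbhd ρ) : ∀ᶠ y in 𝓝[≠] x, Ψ y ≠ Ψ x := by
  have hmer : ∀ y ∈ U.nbhd ρ, IsMeromorphicAt Ψ y := fun y hy => hΨ y (U.nbhd_subset ρ hy).1
  refine (hmer x hx).eventually_eq_or_eventually_ne.resolve_left fun h => ?_
  have hconst : ∀ y ∈ U.nbhd ρ, Ψ y = Ψ x := fun y hy =>
    eq_of_isPreconnected_of_eventually_eq (U.isPreconnected_nbhd ρ) hmer hx h hy
  have hvalue : Ψ x = U.value := eq_of_forall_mem_sphericalDisk fun ρ' hρ' => by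
    obtain ⟨y, hy⟩ := U.nbhd_nonempty (min ρ ⟨ρ', hρ'⟩)
    rw [← hconst y (U.mono (min_le_left _ _) hy)]
    exact (U.nbhd_subset ⟨ρ', hρ'⟩ (U.mono (min_le_right _ _) hy)).2
  obtain ⟨y, hy, hne⟩ := hU.exists_ne ρ
  exact hne ((hconst y hy).trans hvalue)

end

section Separate

variable {M : Type*} [TopologicalSpace M] [T2Space M] [ChartedSpace ℂ M] {Ψ : M → OnePoint ℂ}
  {e : M} {U : Branch Ψ e} {ρ : Ioi (0 : ℝ)}

theorem iInter_nbhd_ofPoint (hΨ : ∀ x, x ≠ e → ContinuousAt Ψ x) {p : M} (hp : p ≠ e)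
    (hiso : ∀ᶠ x in 𝓝[≠] p, Ψ x ≠ Ψ p) : (⋂ ρ, (ofPoint Ψ hp).nbhd ρ) = {p} := by
  have : LocallyCompactSpace M := ChartedSpace.locallyCompactSpace ℂ M
  refine Subset.antisymm (fun y hy => ?_)
    (singleton_subset_iff.2 (mem_iInter.2 (mem_nbhd_ofPoint hp)))
  by_contra hne
  obtain ⟨ρ', hρ', hsub⟩ := exists_connectedComponentIn_diskPreimage_subset hΨ hp hiso
    (isOpen_ne.mem_nhds (Ne.symm hne))
  exact hsub (mem_iInter.1 hy ⟨ρ', hρ'⟩) rfl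

theorem IsTranscendental.not_isCriticalPoint (hΨ : ∀ p, p ≠ e → IsMeromorphicAt Ψ p)
    (hU : U.IsTranscendental)
    (hsep : ∀ V : Branch Ψ e, V.IsSingularity → V ≠ U → ∃ ρ₂, Disjoint (U.nbhd ρ) (V.nbhd ρ₂))
    {x : M} (hx : x ∈ U.nbhd ρ) : ¬ IsCriticalPoint Ψ x := by
  intro hcrit
  have hxe := (U.nbhd_subset ρ hx).1
  have hinter := iInter_nbhd_ofPoint (fun p hp => (hΨ p hp).continuousAt) hxe
    (hU.eventually_ne hΨ hx)
  obtain ⟨ρ₂, hdisj⟩ := hsep (ofPoint Ψ hxe) (Or.inl ⟨x, hinter, hcrit⟩) fun h =>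
    (singleton_nonempty x).ne_empty (hinter.symm.trans (h ▸ hU))
  exact disjoint_left.1 hdisj hx (mem_nbhd_ofPoint hxe ρ₂)

-- The curve converges to a branch over `b`; this branch meets `U`, so it is not a singularity, and
-- the point where it is centred is the limit.
theorem IsTranscendental.exists_tendsto (hΨ : ∀ p, p ≠ e → IsMeromorphicAt Ψ p)
    (hU : U.IsTranscendental)
    (hsep : ∀ V : Branch Ψ e, V.IsSingularity → V ≠ U → ∃ ρ₂, Disjoint (U.nbhd ρ) (V.nbhd ρ₂))
    {c : ℝ → M} {t : ℝ} (ht : 0 < t) (hc : ContinuousOn c (Ico 0 t))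
    (hcU : ∀ s ∈ Ico 0 t, c s ∈ U.nbhd ρ) {b : OnePoint ℂ} (hbD : b ∈ sphericalDisk U.value ρ)
    (hba : b ≠ U.value) (hb : Tendsto (Ψ ∘ c) (𝓝[<] t) (𝓝 b)) :
    ∃ x ∈ U.nbhd ρ, Tendsto c (𝓝[<] t) (𝓝 x) := by
  have : LocallyCompactSpace M := ChartedSpace.locallyCompactSpace ℂ M
  obtain ⟨V, rfl, hV⟩ := exists_branch_of_tendsto ht hc
    (fun s hs => (U.nbhd_subset ρ (hcU s hs)).1) hb
  have hmeet : ∀ ρ₂, (V.nbhd ρ₂ ∩ U.nbhd ρ).Nonempty := fun ρ₂ => by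
    obtain ⟨s, hs, hsI⟩ := ((hV ρ₂).and (Ico_mem_nhdsLT ht)).exists
    exact ⟨c s, hs, hcU s hsI⟩
  have hns : ¬ V.IsSingularity := fun h => by
    obtain ⟨ρ₂, hdisj⟩ := hsep V h fun h => hba (h ▸ rfl)
    obtain ⟨z, hzV, hzU⟩ := hmeet ρ₂
    exact disjoint_left.1 hdisj hzU hzV
  obtain ⟨x, hx⟩ : (⋂ ρ, V.nbhd ρ).Nonempty :=
    nonempty_iff_ne_empty.2 fun h => hns (Or.inr h)
  rw [mem_iInter] at hx
  have hxV : Ψ x = V.value := eq_value_of_forall_mem hx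
  obtain ⟨ρ', hρ', hsub⟩ :=
    exists_sphericalDisk_subset ((isOpen_sphericalDisk U.value ρ).mem_nhds hbD)
  have hxU : x ∈ U.nbhd ρ := U.nbhd_subset_nbhd V (ρ' := ⟨ρ', hρ'⟩) hsub (hmeet _) (hx _)
  refine ⟨x, hxU, fun N hN => ?_⟩
  obtain ⟨ρ₂, hρ₂, hsub⟩ := exists_connectedComponentIn_diskPreimage_subset
    (fun p hp => (hΨ p hp).continuousAt) (U.nbhd_subset ρ hxU).1 (hU.eventually_ne hΨ hxU) hN
  have heq := V.nbhd_eq (hx ⟨ρ₂, hρ₂⟩)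
  rw [← hxV] at heq
  filter_upwards [hV ⟨ρ₂, hρ₂⟩] with s hs
  rw [heq] at hs
  exact hsub hs

end Separate

end Branch

/-! ### Separate singularities are logarithmic -/

namespace Branch

variable {M : Type*} [TopologicalSpace M] {Ψ : M → OnePoint ℂ} {e : M} {U V : Branch Ψ e}
  {ρ r : Ioi (0 : ℝ)} {x : M}

theorem connectedSpace_nbhd (U : Branch Ψ e) (ρ : Ioi (0 : ℝ)) : ConnectedSpace (U.nbhd ρ) :=
  Subtype.connectedSpace ⟨U.nbhd_nonempty ρ, U.isPreconnected_nbhd ρ⟩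

/-- The neighbourhood `U_a(ρ)` as a surface, with the charts of `M`. -/
abbrev chartedSpaceNbhd [ChartedSpace ℂ M] [T1Space M] (hΨ : ∀ p, p ≠ e → ContinuousAt Ψ p)
    (U : Branch Ψ e) (ρ : Ioi (0 : ℝ)) : ChartedSpace ℂ (U.nbhd ρ) :=
  have := ChartedSpace.locallyConnectedSpace ℂ M
  inferInstanceAs (ChartedSpace ℂ (⟨U.nbhd ρ, U.isOpen_nbhd hΨ ρ⟩ : TopologicalSpace.Opens M))

theorem isLocalHomeomorph_domRestrict [ChartedSpace ℂ M] [T1Space M]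
    (hΨ : ∀ p, p ≠ e → IsMeromorphicAt Ψ p) (hcrit : ∀ x ∈ U.nbhd ρ, ¬ IsCriticalPoint Ψ x) :
    IsLocalHomeomorph ((U.nbhd ρ).domRestrict Ψ) := by
  have := ChartedSpace.locallyConnectedSpace ℂ M
  have hopen : IsOpen (U.nbhd ρ) := U.isOpen_nbhd (fun p hp => (hΨ p hp).continuousAt) ρ
  have hon : IsLocalHomeomorphOn Ψ (U.nbhd ρ) := .mk _ _ fun x hx =>
    (hΨ x (U.nbhd_subset ρ hx).1).exists_openPartialHomeomorph (hcrit x hx)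
  rw [isLocalHomeomorph_iff_isLocalHomeomorphOn_univ]
  exact hon.comp hopen.isOpenEmbedding_subtypeVal.isLocalHomeomorph.isLocalHomeomorphOn
    fun x _ => x.2

theorem mem_nbhd_of_hasPolarLifts [ChartedSpace ℂ M] [T2Space M]
    (hΨ : ∀ p, p ≠ e → ContinuousAt Ψ p) (hq : IsLocalHomeomorph ((U.nbhd ρ).domRestrict Ψ))
    (hlifts : HasPolarLifts ((U.nbhd ρ).domRestrict Ψ) U.value ρ) (hr : r ≤ ρ)
    (hx : x ∈ U.nbhd ρ) (hxr : Ψ x ∈ sphericalDisk U.value r) : x ∈ U.nbhd r := by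
  have := U.connectedSpace_nbhd ρ
  let _ := U.chartedSpaceNbhd hΨ ρ
  refine U.subset_nbhd ((hlifts.isPreconnected_preimage_sphericalDisk hq ρ.2 r).image Subtype.val
    continuous_subtype_val.continuousOn) ?_ ?_ ⟨⟨x, hx⟩, hxr, rfl⟩
  · rintro _ ⟨y, hy, rfl⟩
    exact ⟨(U.nbhd_subset ρ y.2).1, hy⟩
  · obtain ⟨y, hy⟩ := U.nbhd_nonempty r
    exact ⟨y, ⟨⟨y, U.mono hr hy⟩, (U.nbhd_subset r hy).2, rfl⟩, hy⟩

theorem IsTranscendental.map_ne_value [ChartedSpace ℂ M] [T2Space M]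
    (hΨ : ∀ p, p ≠ e → ContinuousAt Ψ p) (hU : U.IsTranscendental)
    (hq : IsLocalHomeomorph ((U.nbhd ρ).domRestrict Ψ))
    (hlifts : HasPolarLifts ((U.nbhd ρ).domRestrict Ψ) U.value ρ) (hx : x ∈ U.nbhd ρ) :
    Ψ x ≠ U.value := fun hxa =>
  Set.notMem_empty x (Eq.subset hU (mem_iInter.2 fun r => U.mono (min_le_right ρ r)
    (mem_nbhd_of_hasPolarLifts hΨ hq hlifts (min_le_left ρ r) hx
      (hxa ▸ mem_sphericalDisk_self _ (min ρ r).2))))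

theorem IsTranscendental.hasPolarLifts [ChartedSpace ℂ M] [T2Space M]
    (hΨ : ∀ p, p ≠ e → IsMeromorphicAt Ψ p) (hU : U.IsTranscendental)
    (hsep : ∀ V : Branch Ψ e, V.IsSingularity → V ≠ U → ∃ ρ₂, Disjoint (U.nbhd ρ) (V.nbhd ρ₂))
    (hq : IsLocalHomeomorph ((U.nbhd ρ).domRestrict Ψ)) :
    HasPolarLifts ((U.nbhd ρ).domRestrict Ψ) U.value ρ := by
  refine hasPolarLifts_of_forall_exists_path_lift hq (fun y => (U.nbhd_subset ρ y.2).2)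
    fun γ y hγ hy => exists_path_lift_of_forall_tendsto hq γ hy fun t ht c hc => ?_
  let γ' : ℝ → OnePoint ℂ := IccExtend zero_le_one γ
  have hγ' : ∀ s, γ' s ∈ sphericalDisk U.value ρ ∩ range (polar U.value) := fun s => hγ _
  obtain ⟨w, hw⟩ := (hγ' t).2
  have hΨc : Tendsto (Ψ ∘ Subtype.val ∘ c) (𝓝[<] t) (𝓝 (γ' t)) := by
    refine (γ.continuous.Icc_extend'.continuousAt.tendsto.mono_left nhdsWithin_le_nhds).congr' ?_
    filter_upwards [Ico_mem_nhdsLT ht.1] with s hs using (hc.map_apply s hs).symm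
  obtain ⟨x, hx, hlim⟩ := hU.exists_tendsto hΨ hsep ht.1 (c := Subtype.val ∘ c)
    (continuous_subtype_val.comp_continuousOn hc.continuousOn) (fun s _ => (c s).2) (hγ' t).1
    (hw ▸ polar_ne U.value w) hΨc
  exact ⟨⟨x, hx⟩, tendsto_subtype_rng.2 hlim⟩

theorem mem_nbhd_of_mem_closure_of_lt [LocallyConnectedSpace M] [T1Space M]
    (hΨ : ∀ p, p ≠ e → ContinuousAt Ψ p) (hr : r < ρ) (hx : x ∈ closure (U.nbhd r))
    (hxe : x ≠ e) : x ∈ U.nbhd ρ ∧ sphericalDist (Ψ x) U.value ≤ r := by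
  have hdist : sphericalDist (Ψ x) U.value ≤ r :=
    closure_sphericalDisk_subset _ _ (mem_closure_iff_nhds.2 fun N hN => by
      obtain ⟨y, hy, hyU⟩ := mem_closure_iff_nhds.1 hx _ (hΨ x hxe hN)
      exact ⟨Ψ y, hy, (U.nbhd_subset r hyU).2⟩)
  exact ⟨U.mem_nbhd_of_mem_closure hΨ (closure_mono (U.mono hr.le) hx)
    ⟨hxe, hdist.trans_lt hr⟩, hdist⟩

-- A punctured neighbourhood of `e` that avoids the compact circle of radius `r` cannot leave
-- `U_a(r)`.
theorem tendsto_of_isCompact [ChartedSpace ℂ M] [T2Space M]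
    (hΨ : ∀ p, p ≠ e → ContinuousAt Ψ p) (hUe : U.AccumulatesAtEssential)
    (hcpt : ∀ r : ℝ, IsCompact {y | sphericalDist ((U.nbhd ρ).domRestrict Ψ y) U.value = r}) :
    Tendsto Ψ (𝓝[≠] e) (𝓝 U.value) := by
  have := ChartedSpace.locallyConnectedSpace ℂ M
  intro N hN
  obtain ⟨ρ₀, hρ₀, hsub⟩ := exists_sphericalDisk_subset hN
  obtain ⟨r, hr⟩ := exists_between (lt_min hρ₀ ρ.2)
  lift r to Ioi (0 : ℝ) using hr.1
  let circle : Set M := Subtype.val '' {y : U.nbhd ρ | sphericalDist (Ψ y) U.value = r}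
  have hcircle : IsClosed circle := ((hcpt r).image continuous_subtype_val).isClosed
  have he : e ∉ circle := by
    rintro ⟨y, -, hy⟩
    exact (U.nbhd_subset ρ y.2).1 hy
  obtain ⟨P, hP, hPconn, hPsub⟩ := exists_isPreconnected_mem_nhdsNE (E := ℂ) (by simp)
    (inter_mem self_mem_nhdsWithin (nhdsWithin_le_nhds (hcircle.isOpen_compl.mem_nhds he)))
  have hPU : P ⊆ U.nbhd r := by
    refine hPconn.subset_of_closure_inter_subset (U.isOpen_nbhd hΨ r) ?_ fun x ⟨hx, hxP⟩ => ?_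
    · obtain ⟨x, rfl | hx, hxU⟩ := mem_closure_iff_nhds.1 (hUe r) _ (insert_mem_nhds_iff.2 hP)
      · exact absurd rfl (U.nbhd_subset r hxU).1
      · exact ⟨x, hx, hxU⟩
    · obtain ⟨hxe, hxcircle⟩ := hPsub hxP
      obtain ⟨hxU, hdist⟩ :=
        mem_nbhd_of_mem_closure_of_lt hΨ (hr.2.trans_le (min_le_right _ _)) hx hxe
      exact U.mem_nbhd_of_mem_closure hΨ hx
        ⟨hxe, hdist.lt_of_ne fun h => hxcircle ⟨⟨x, hxU⟩, h, rfl⟩⟩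
  refine mem_map.2 (mem_of_superset hP fun x hx => ?_)
  exact hsub ((U.nbhd_subset r (hPU hx)).2.trans (hr.2.trans_le (min_le_left _ _)))

theorem IsSeparate.isLogarithmic [ChartedSpace ℂ M] [T2Space M]
    (hΨ : IsTranscendentalMeromorphic Ψ e) (hU : U.IsTranscendental)
    (hUe : U.AccumulatesAtEssential) (hsep : U.IsSeparate) : U.IsLogarithmic := by
  obtain ⟨ρ₁, hsep⟩ := hsep
  let ρ : Ioi (0 : ℝ) := min ρ₁ ⟨Real.pi, Real.pi_pos⟩
  have hρ : (ρ : ℝ) ≤ Real.pi := min_le_right ρ₁ _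
  have hsep : ∀ V : Branch Ψ e, V.IsSingularity → V ≠ U →
      ∃ ρ₂, Disjoint (U.nbhd ρ) (V.nbhd ρ₂) := fun V hV hne =>
    (hsep V hV hne).imp fun _ h => h.mono_left (U.mono (min_le_left _ _))
  have hcont : ∀ p, p ≠ e → ContinuousAt Ψ p := fun p hp => (hΨ.1 p hp).continuousAt
  have hq : IsLocalHomeomorph ((U.nbhd ρ).domRestrict Ψ) :=
    isLocalHomeomorph_domRestrict hΨ.1 fun x hx => hU.not_isCriticalPoint hΨ.1 hsep hx
  have hlifts := hU.hasPolarLifts hΨ.1 hsep hq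
  have hmaps : MapsTo Ψ (U.nbhd ρ) (sphericalDisk U.value ρ \ {U.value}) := fun x hx =>
    ⟨(U.nbhd_subset ρ hx).2, hU.map_ne_value hcont hq hlifts hx⟩
  have := U.connectedSpace_nbhd ρ
  let _ := U.chartedSpaceNbhd hcont ρ
  obtain ⟨F, hF, hrange⟩ := hlifts.exists_isPolarLift hq ρ.2
  have hsurj : Function.Surjective F := range_eq_univ.1 <| hrange.trans <|
    eq_univ_of_forall fun x => sphericalDisk_sdiff_center_subset_range_polar hρ (hmaps x.2)
  have hinj : Function.Injective F := by
    by_contra hinj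
    exact hΨ.2 ⟨U.value, tendsto_of_isCompact hcont hUe
      (hF.isCompact_sphericalDist_eq hq hsurj hinj)⟩
  exact ⟨hU, ρ, hmaps, hF.isCoveringMap_codRestrict hq ⟨hinj, hsurj⟩ hρ fun x => hmaps x.2,
    hF.simplyConnectedSpace hq ⟨hinj, hsurj⟩ ρ.2⟩

end Branch

/-! ### Logarithmic singularities are separate -/

namespace Branch

variable {M : Type*} [TopologicalSpace M] {Ψ : M → OnePoint ℂ} {e : M} {U V : Branch Ψ e}
  {ρ : Ioi (0 : ℝ)}

theorem eq_of_hasPolarLifts [ChartedSpace ℂ M] [T2Space M]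
    (hΨ : ∀ p, p ≠ e → ContinuousAt Ψ p) (hq : IsLocalHomeomorph ((U.nbhd ρ).domRestrict Ψ))
    (hlifts : HasPolarLifts ((U.nbhd ρ).domRestrict Ψ) U.value ρ) (hv : V.value = U.value)
    (hmeet : ∀ ρ₂, (V.nbhd ρ₂ ∩ U.nbhd ρ).Nonempty) : V = U := by
  refine eq_of_forall_meet hv fun r => ⟨min ρ r, min_le_right _ _, ?_⟩
  obtain ⟨y, hyV, hyU⟩ := hmeet (min ρ r)
  exact ⟨y, hyV, mem_nbhd_of_hasPolarLifts hΨ hq hlifts (min_le_left _ _) hyU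
    (hv ▸ (V.nbhd_subset _ hyV).2)⟩

theorem exists_section_of_isEvenlyCovered_value {F : Type*} [TopologicalSpace F]
    (hev : IsEvenlyCovered ((U.nbhd ρ).domRestrict Ψ) V.value F)
    (hD : V.value ∈ sphericalDisk U.value ρ) (hmeet : ∀ ρ₂, (V.nbhd ρ₂ ∩ U.nbhd ρ).Nonempty) :
    ∃ (r : Ioi (0 : ℝ)) (s : C(sphericalDisk V.value r, U.nbhd ρ)), (∀ y, Ψ (s y) = y) ∧
      ∀ x (hx : x ∈ V.nbhd r), (s ⟨Ψ x, (V.nbhd_subset r hx).2⟩ : M) = x := by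
  obtain ⟨N, hN, hsection⟩ := exists_section_of_isEvenlyCovered hev
  obtain ⟨r, hr, hsub⟩ := exists_sphericalDisk_subset
    (inter_mem hN ((isOpen_sphericalDisk U.value ρ).mem_nhds hD))
  lift r to Ioi (0 : ℝ) using hr
  have hVU : V.nbhd r ⊆ U.nbhd ρ :=
    U.nbhd_subset_nbhd V (fun _ hy => (hsub hy).2) (hmeet r)
  obtain ⟨x₀, hx₀⟩ := V.nbhd_nonempty r
  obtain ⟨s, hs, hsV⟩ := hsection (Subtype.val ⁻¹' V.nbhd r)
    (isPreconnected_preimage_subtypeVal (V.isPreconnected_nbhd r) hVU) ⟨⟨x₀, hVU hx₀⟩, hx₀⟩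
    fun _ hx => (hsub (V.nbhd_subset r hx).2).1
  exact ⟨r, s.comp ⟨inclusion fun y hy => (hsub hy).1, continuous_inclusion _⟩,
    fun y => hs _, fun x hx => congrArg Subtype.val (hsV ⟨x, hVU hx⟩ hx)⟩

theorem section_apply_value_mem_nbhd {r : Ioi (0 : ℝ)} {s : C(sphericalDisk V.value r, U.nbhd ρ)}
    (hs : ∀ y, Ψ (s y) = y)
    (hsV : ∀ x (hx : x ∈ V.nbhd r), (s ⟨Ψ x, (V.nbhd_subset r hx).2⟩ : M) = x)
    (ρ₂ : Ioi (0 : ℝ)) : (s ⟨V.value, mem_sphericalDisk_self _ r.2⟩ : M) ∈ V.nbhd ρ₂ := by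
  let B : Set (sphericalDisk V.value r) :=
    Subtype.val ⁻¹' sphericalDisk V.value (min r ρ₂ : Ioi (0 : ℝ))
  have hB : IsPreconnected B := isPreconnected_preimage_subtypeVal
    (isPreconnected_sphericalDisk V.value _) (sphericalDisk_mono V.value (min_le_left r ρ₂))
  have hsB : IsPreconnected ((fun y => (s y : M)) '' B) := hB.image _
    (continuous_subtype_val.comp s.continuous).continuousOn
  have hcenter : V.value ∈ sphericalDisk V.value (min r ρ₂ : Ioi (0 : ℝ)) :=
    mem_sphericalDisk_self _ (min r ρ₂).2
  refine V.mono (min_le_right r ρ₂) (V.subset_nbhd hsB ?_ ?_ (mem_image_of_mem _ hcenter))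
  · rintro _ ⟨y, hy, rfl⟩
    exact ⟨(U.nbhd_subset ρ (s y).2).1, (hs y).symm ▸ hy⟩
  · obtain ⟨x, hx⟩ := V.nbhd_nonempty (min r ρ₂)
    exact ⟨x, ⟨⟨Ψ x, _⟩, (V.nbhd_subset _ hx).2, hsV x (V.mono (min_le_left r ρ₂) hx)⟩, hx⟩

theorem not_isSingularity_of_forall_mem_nbhd [ChartedSpace ℂ M] {s : Set M} (hs : IsOpen s)
    (hinj : IsLocallyInjective (s.domRestrict Ψ)) {z : s} (hz : ∀ ρ, (z : M) ∈ V.nbhd ρ) :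
    ¬ V.IsSingularity := by
  have hinter : (z : M) ∈ ⋂ ρ, V.nbhd ρ := mem_iInter.2 hz
  rintro (⟨z₁, hz₁, hcrit⟩ | htr)
  · obtain rfl : (z : M) = z₁ := hz₁.subset hinter
    obtain ⟨N, hN, hinjN⟩ := isLocallyInjective_iff_nhds.1 hinj z
    exact not_isCriticalPoint_of_injOn (hs.isOpenEmbedding_subtypeVal.image_mem_nhds.2 hN)
      hinjN.image_of_comp hcrit
  · exact Eq.subset htr hinter

theorem hasPolarLifts_of_isCoveringMap [T2Space M]
    {h : MapsTo Ψ (U.nbhd ρ) (sphericalDisk U.value ρ \ {U.value})}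
    (hcov : IsCoveringMap h.restrict) (hq : IsLocalHomeomorph ((U.nbhd ρ).domRestrict Ψ)) :
    HasPolarLifts ((U.nbhd ρ).domRestrict Ψ) U.value ρ := by
  refine hasPolarLifts_of_forall_exists_path_lift hq (fun x => (h x.2).1) fun γ x hγ hx => ?_
  have hγ' : ∀ t, γ t ∈ sphericalDisk U.value ρ \ {U.value} := fun t => by
    obtain ⟨ht, w, hw⟩ := hγ t
    exact ⟨ht, hw ▸ polar_ne U.value w⟩
  obtain ⟨Γ, hΓ, hΓ0⟩ := hcov.exists_path_lifts ⟨fun t => ⟨γ t, hγ' t⟩, by fun_prop⟩ x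
    (Subtype.ext hx.symm)
  exact ⟨Γ, hΓ0, fun t => congrArg Subtype.val (congrFun hΓ t)⟩

theorem IsLogarithmic.isSeparate [T2Space M] [ChartedSpace ℂ M]
    (hΨ : ∀ p, p ≠ e → IsMeromorphicAt Ψ p) (hU : U.IsLogarithmic) : U.IsSeparate := by
  have := ChartedSpace.locallyConnectedSpace ℂ M
  have hcont : ∀ p, p ≠ e → ContinuousAt Ψ p := fun p hp => (hΨ p hp).continuousAt
  obtain ⟨-, ρ, h, hcov, -⟩ := hU
  have hcovOn : IsCoveringMapOn ((U.nbhd ρ).domRestrict Ψ)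
      (sphericalDisk U.value ρ \ {U.value}) :=
    .of_isCoveringMap_subtype ((isOpen_sphericalDisk _ _).sdiff isClosed_singleton)
      (fun x => h x.2) hcov
  have hq : IsLocalHomeomorph ((U.nbhd ρ).domRestrict Ψ) :=
    isLocalHomeomorph_iff_isLocalHomeomorphOn_univ.2 <|
      hcovOn.isLocalHomeomorphOn.mono fun x _ => h x.2
  obtain ⟨ρ₁, hρ₁, hlt⟩ := exists_between (mem_Ioi.1 ρ.2)
  lift ρ₁ to Ioi (0 : ℝ) using hρ₁
  refine ⟨ρ₁, fun V hV hne => ?_⟩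
  by_contra! hdisj
  have hmeet : ∀ ρ₂, (V.nbhd ρ₂ ∩ U.nbhd ρ₁).Nonempty := fun ρ₂ =>
    inter_comm (U.nbhd ρ₁) _ ▸ not_disjoint_iff_nonempty_inter.1 (hdisj ρ₂)
  have hmeetρ : ∀ ρ₂, (V.nbhd ρ₂ ∩ U.nbhd ρ).Nonempty := fun ρ₂ =>
    (hmeet ρ₂).mono (inter_subset_inter_right _ (U.mono hlt.le))
  by_cases hv : V.value = U.value
  · exact hne (eq_of_hasPolarLifts hcont hq (hasPolarLifts_of_isCoveringMap hcov hq) hv hmeetρ)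
  by_cases hD : V.value ∈ sphericalDisk U.value ρ
  · obtain ⟨r, s, hs, hsV⟩ :=
      exists_section_of_isEvenlyCovered_value (hcovOn _ ⟨hD, hv⟩) hD hmeetρ
    exact not_isSingularity_of_forall_mem_nbhd (U.isOpen_nbhd hcont ρ) hq.isLocallyInjective
      (section_apply_value_mem_nbhd hs hsV) hV
  · have hclosure : V.value ∉ closure (sphericalDisk U.value ρ₁) := fun hmem =>
      hD ((closure_sphericalDisk_subset _ _ hmem).trans_lt hlt)
    obtain ⟨ρ₂, hρ₂, hsub⟩ :=
      exists_sphericalDisk_subset (isClosed_closure.isOpen_compl.mem_nhds hclosure)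
    obtain ⟨x, hxV, hxU⟩ := hmeet ⟨ρ₂, hρ₂⟩
    exact hsub (V.nbhd_subset _ hxV).2 (subset_closure (U.nbhd_subset _ hxU).2)

end Branch

end InverseSingularity

end

theorem mainTheorem12_general {M : Type*} [TopologicalSpace M] [T2Space M] [ChartedSpace ℂ M]
    (Ψ : M → OnePoint ℂ) (e : M)
    (hΨ : InverseSingularity.IsTranscendentalMeromorphic Ψ e)
    (U : InverseSingularity.Branch Ψ e) (hU : U.IsTranscendental)
    (hUe : U.AccumulatesAtEssential) :
    U.IsLogarithmic ↔ U.IsSeparate :=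
  ⟨fun h => h.isSeparate hΨ.1, fun h => h.isLogarithmic hΨ hU hUe⟩

theorem mainTheorem12 {M : Type*} [TopologicalSpace M] [T2Space M] [ConnectedSpace M]
    [ChartedSpace ℂ M] [IsManifold 𝓘(ℂ) ω M]
    (Ψ : M → OnePoint ℂ) (e : M)
    (hΨ : InverseSingularity.IsTranscendentalMeromorphic Ψ e)
    (U : InverseSingularity.Branch Ψ e) (hU : U.IsTranscendental)
    (hUe : U.AccumulatesAtEssential) :
    ¬ U.IsLogarithmic ↔ ¬ U.IsSeparate :=
  not_congr (mainTheorem12_general Ψ e hΨ U hU hUe)
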